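/- Let $\mathfrak F\in\{\mathbb R,\mathbb C,\mathbb H,\mathbb O\}$ be a real normed division algebra (reals, complex numbers, quaternions, octonions) and let $\beta=\dim_{\mathbb R}\mathfrak F\in\{1,2,4,8\}$. Let $k\ge 0$, $m\ge 1$ and $n_0,\dots,n_k\ge m$ be integers and $n=n_0+\cdots+n_k$. For a matrix $A$ over $\mathfrak F$ let $A^H$ be its conjugate transpose. Let $\mathfrak P_m^\beta$ be the cone of positive definite Hermitian $m\times m$ matrices over $\mathfrak F$, i.e. of the $S=S^H$ with $\operatorname{Re}(p^H(Sp))>0$ for all nonzero columns $p\in\mathfrak F^m$. For $S\in\mathfrak P_m^\beta$ let $|S|>0$ be its determinant, that is, $|S|^\beta$ is the determinant of the real-linear operator $p\mapsto Sp$ on $\mathfrak F^m\cong\mathbb R^{\beta m}$ (for $\mathbb R$, $\mathbb C$ this is the usual determinant). Let $(dS)=\prod_{i}ds_{ii}\prod_{i<j}\prod_{r=1}^{\beta}ds_{ij}^{(r)}$ be Lebesgue measure on Hermitian matrices, where $s_{ij}^{(r)}$ are the standard real coordinates of $s_{ij}$, and put $$\Gamma_m^\beta[a]=\int_{\mathfrak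 P_m^\beta}e^{-\operatorname{tr}A}\,|A|^{a-(m-1)\beta/2-1}\,(dA).$$ Let $h:\mathbb R\to\mathbb R$ be measurable and nonnegative on $[0,\infty)$, and let $X=(X_0^H,\dots,X_k^H)^H$, with blocks $X_i$ of size $n_i\times m$, be a random $n\times m$ matrix over $\mathfrak F$ which has a matrix variate spherical distribution with kernel $h$, i.e. $X$ has density $h(\beta\operatorname{tr}X^HX)$ with respect to Lebesgue measure on $\mathfrak F^{n\times m}\cong\mathbb R^{\beta nm}$. Then: (i) The random vector $(V_0,\dots,V_k)$, $V_i=\operatorname{tr}X_i^HX_i$, has on $(0,\infty)^{k+1}$ the density $$\pi^{nm\beta/2}\prod_{i=0}^k\frac{v_i^{n_im\beta/2-1}}{\Gamma_1^\beta[n_im\beta/2]}\;h\Big(\beta\sum_{i=0}^kv_i\Big)$$ with respect to $dv_0\cdots dv_k$ (multivariate generalised Gamma distribution). (ii) If $\mathfrak F=\mathbb O$, assume $m\le 2$. The random matrices $(\mathbf V_0,\dots,\mathbf V_k)$, $\mathbf V_i=X_i^HX_i$, have on $(\mathfrak P_m^\beta)^{k+1}$ the joint density $$\pi^{\beta nm/2}\prod_{i=0}^k\frac{|\mathbf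 V_i|^{\beta(n_i-m+1)/2-1}}{\Gamma_m^\beta[\beta n_i/2]}\;h\Big(\beta\operatorname{tr}\sum_{i=0}^k\mathbf V_i\Big)$$ with respect to $(d\mathbf V_0)\cdots(d\mathbf V_k)$ (multimatricvariate generalised Wishart distribution). -/

import Mathlib

open MeasureTheory
open scoped Matrix

noncomputable section

/-! ### Octonions and the Borel structure of the quaternions -/

instance Quaternion.instMeasurableSpaceReal : MeasurableSpace (Quaternion ℝ) := borel _

instance Quaternion.instBorelSpaceReal : BorelSpace (Quaternion ℝ) := ⟨rfl⟩

/-- The octonions, as the Cayley-Dickson double of the quaternions. As a real vector space (and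
as a measure space, with Lebesgue measure in the eight real coordinates) this is `ℍ × ℍ`. -/
def Octonion : Type := Quaternion ℝ × Quaternion ℝ

namespace Octonion

instance : AddCommGroup Octonion := inferInstanceAs (AddCommGroup (Quaternion ℝ × Quaternion ℝ))

instance : Module ℝ Octonion := inferInstanceAs (Module ℝ (Quaternion ℝ × Quaternion ℝ))

instance : MeasureSpace Octonion := inferInstanceAs (MeasureSpace (Quaternion ℝ × Quaternion ℝ))

/-- The Cayley-Dickson product `(a, b) (c, d) = (a c - d̄ b, d a + b c̄)`. -/
instance : Mul Octonion :=
  ⟨fun x y => (x.1 * y.1 - star y.2 * x.2, y.2 * x.1 + x.2 * star y.1)⟩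

instance : One Octonion := ⟨((1 : Quaternion ℝ), (0 : Quaternion ℝ))⟩

/-- Octonionic conjugation `(a, b) ↦ (ā, -b)`. -/
instance : Star Octonion := ⟨fun x => (star x.1, -x.2)⟩

@[simp] theorem mul_fst (x y : Octonion) : (x * y).1 = x.1 * y.1 - star y.2 * x.2 := rfl

@[simp] theorem mul_snd (x y : Octonion) : (x * y).2 = y.2 * x.1 + x.2 * star y.1 := rfl

@[simp] theorem one_fst : (1 : Octonion).1 = 1 := rfl

@[simp] theorem one_snd : (1 : Octonion).2 = 0 := rfl

@[simp] theorem star_fst (x : Octonion) : (star x).1 = star x.1 := rfl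

@[simp] theorem star_snd (x : Octonion) : (star x).2 = -x.2 := rfl

@[simp] theorem add_fst (x y : Octonion) : (x + y).1 = x.1 + y.1 := rfl

@[simp] theorem add_snd (x y : Octonion) : (x + y).2 = x.2 + y.2 := rfl

@[simp] theorem zero_fst : (0 : Octonion).1 = 0 := rfl

@[simp] theorem zero_snd : (0 : Octonion).2 = 0 := rfl

@[simp] theorem smul_fst (r : ℝ) (x : Octonion) : (r • x).1 = r • x.1 := rfl

@[simp] theorem smul_snd (r : ℝ) (x : Octonion) : (r • x).2 = r • x.2 := rfl

instance : NonAssocRing Octonion :=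
  { (inferInstance : AddCommGroup Octonion), (inferInstance : Mul Octonion),
    (inferInstance : One Octonion) with
    left_distrib := fun x y z => by
      apply Prod.ext <;> simp [mul_add, add_mul] <;> abel
    right_distrib := fun x y z => by
      apply Prod.ext <;> simp [mul_add, add_mul] <;> abel
    zero_mul := fun x => by apply Prod.ext <;> simp
    mul_zero := fun x => by apply Prod.ext <;> simp
    one_mul := fun x => by apply Prod.ext <;> simp
    mul_one := fun x => by apply Prod.ext <;> simp }

theorem mul_real_smul (r : ℝ) (x y : Octonion) : x * (r • y) = r • (x * y) := by
  apply Prod.ext <;> simp [smul_sub, smul_add]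

end Octonion

/-! ### The four real normed division algebras -/

/-- Labels for the four real finite-dimensional normed division algebras `ℝ`, `ℂ`, `ℍ`, `𝕆`. -/
inductive NormedDivAlg where
  | real
  | complex
  | quaternion
  | octonion

namespace NormedDivAlg

/-- The underlying set of the algebra. -/
def Carrier : NormedDivAlg → Type
  | real => ℝ
  | complex => ℂ
  | quaternion => Quaternion ℝ
  | octonion => Octonion

instance : CoeSort NormedDivAlg Type := ⟨Carrier⟩

/-- The dimension `β` of the algebra over `ℝ`. -/
def dim : NormedDivAlg → ℕ
  | real => 1
  | complex => 2
  | quaternion => 4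
  | octonion => 8

instance : (𝔸 : NormedDivAlg) → NonAssocRing 𝔸
  | real => inferInstanceAs (NonAssocRing ℝ)
  | complex => inferInstanceAs (NonAssocRing ℂ)
  | quaternion => inferInstanceAs (NonAssocRing (Quaternion ℝ))
  | octonion => inferInstanceAs (NonAssocRing Octonion)

instance : (𝔸 : NormedDivAlg) → Module ℝ 𝔸
  | real => inferInstanceAs (Module ℝ ℝ)
  | complex => inferInstanceAs (Module ℝ ℂ)
  | quaternion => inferInstanceAs (Module ℝ (Quaternion ℝ))
  | octonion => inferInstanceAs (Module ℝ Octonion)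

/-- Conjugation (trivial on `ℝ`). -/
instance : (𝔸 : NormedDivAlg) → Star 𝔸
  | real => inferInstanceAs (Star ℝ)
  | complex => inferInstanceAs (Star ℂ)
  | quaternion => inferInstanceAs (Star (Quaternion ℝ))
  | octonion => inferInstanceAs (Star Octonion)

/-- Lebesgue measure in the `β` real coordinates. -/
instance : (𝔸 : NormedDivAlg) → MeasureSpace 𝔸
  | real => inferInstanceAs (MeasureSpace ℝ)
  | complex => inferInstanceAs (MeasureSpace ℂ)
  | quaternion => inferInstanceAs (MeasureSpace (Quaternion ℝ))
  | octonion => inferInstanceAs (MeasureSpace Octonion)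

/-- The real part. -/
def re : (𝔸 : NormedDivAlg) → 𝔸 → ℝ
  | real => fun x => x
  | complex => fun z => Complex.re z
  | quaternion => fun q => QuaternionAlgebra.re q
  | octonion => fun x => QuaternionAlgebra.re (Prod.fst x)

theorem mul_real_smul (𝔸 : NormedDivAlg) (r : ℝ) (a b : 𝔸) : a * (r • b) = r • (a * b) := by
  cases 𝔸
  · exact mul_smul_comm (α := ℝ) (β := ℝ) r a b
  · exact mul_smul_comm (α := ℝ) (β := ℂ) r a b
  · exact mul_smul_comm (α := ℝ) (β := Quaternion ℝ) r a b
  · exact Octonion.mul_real_smul r a b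

end NormedDivAlg

/-! ### Matrices, Hermitian matrices and their Lebesgue measures -/

instance Matrix.instMeasurableSpacePi {ι κ α : Type*} [MeasurableSpace α] :
    MeasurableSpace (Matrix ι κ α) := inferInstanceAs (MeasurableSpace (ι → κ → α))

/-- Lebesgue measure on matrices: the product of the measures on the entries. -/
instance Matrix.instMeasureSpacePi {ι κ α : Type*} [Fintype ι] [Fintype κ] [MeasureSpace α] :
    MeasureSpace (Matrix ι κ α) := inferInstanceAs (MeasureSpace (ι → κ → α))

section Hermitian

/-- Real part of the trace; for a Hermitian matrix, the trace is real and this is the trace. -/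
def reTrace {𝔸 : NormedDivAlg} {m : ℕ} (S : Matrix (Fin m) (Fin m) 𝔸) : ℝ := 𝔸.re S.trace

/-- The Hermitian matrix with real diagonal entries `d i` and with entries `u (i, j)`, `i < j`,
above the diagonal. -/
def hermOfCoords (𝔸 : NormedDivAlg) (m : ℕ)
    (c : (Fin m → ℝ) × ({p : Fin m × Fin m // p.1 < p.2} → 𝔸)) : Matrix (Fin m) (Fin m) 𝔸 :=
  Matrix.of fun i j =>
    if hij : i < j then c.2 ⟨(i, j), hij⟩
    else if hji : j < i then star (c.2 ⟨(j, i), hji⟩)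
    else c.1 i • (1 : 𝔸)

/-- The Lebesgue measure `(dS)` of the space of Hermitian `m × m` matrices over `𝔸`, that is
`⋀ᵢ ds_ii ⋀_{i<j} ⋀_r ds_ij^(r)`, as a measure on all matrices carried by the Hermitian ones. -/
def lebesgueHerm (𝔸 : NormedDivAlg) (m : ℕ) : Measure (Matrix (Fin m) (Fin m) 𝔸) :=
  (volume : Measure ((Fin m → ℝ) × ({p : Fin m × Fin m // p.1 < p.2} → 𝔸))).map
    (hermOfCoords 𝔸 m)

variable {𝔸 : NormedDivAlg} {m : ℕ}

/-- Positive definite Hermitian matrices over `𝔸`: `S = Sᴴ` and `Re (pᴴ (S p)) > 0` for every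
column `p ≠ 0`. -/
def IsPosDef (S : Matrix (Fin m) (Fin m) 𝔸) : Prop :=
  Sᴴ = S ∧ ∀ p : Fin m → 𝔸, p ≠ 0 → 0 < 𝔸.re (star p ⬝ᵥ (S *ᵥ p))

/-- The real-linear operator `p ↦ S p` on columns. -/
def mulVecReal (S : Matrix (Fin m) (Fin m) 𝔸) : (Fin m → 𝔸) →ₗ[ℝ] (Fin m → 𝔸) where
  toFun p := S *ᵥ p
  map_add' p q := Matrix.mulVec_add S p q
  map_smul' r p := by
    ext i
    simp [Matrix.mulVec, dotProduct, 𝔸.mul_real_smul, Finset.smul_sum]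

/-- The determinant `|S|` of a positive definite Hermitian matrix over `𝔸`. Each eigenvalue of
`S` has multiplicity `β` in the real-linear operator `p ↦ S p`, whose determinant is therefore
`|S| ^ β`. Over `ℝ` and `ℂ` this is the usual determinant, over `ℍ` the product of the
eigenvalues (the Moore determinant), and for every algebra
`|[[a, x], [x̄, b]]| = a b - ‖x‖²`. -/
def hermDet (S : Matrix (Fin m) (Fin m) 𝔸) : ℝ :=
  LinearMap.det (mulVecReal S) ^ (1 / (𝔸.dim : ℝ))

end Hermitian

/-- The multivariate Gamma function
`Γ_m^β[a] = ∫_{A > 0} etr(-A) |A|^(a - (m-1)β/2 - 1) (dA)`. -/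
def multiGamma (𝔸 : NormedDivAlg) (m : ℕ) (a : ℝ) : ℝ :=
  ∫ A in {A | IsPosDef A},
    Real.exp (-reTrace A) * hermDet A ^ (a - ((m : ℝ) - 1) * 𝔸.dim / 2 - 1) ∂lebesgueHerm 𝔸 m

/-- The random matrix `X` has the matrix variate spherical distribution with kernel `h`: its
density with respect to Lebesgue measure is `h (β tr XᴴX)`. -/
structure IsSpherical {Ω ι : Type*} [MeasurableSpace Ω] [Fintype ι] {𝔸 : NormedDivAlg} {m : ℕ}
    (P : Measure Ω) (h : ℝ → ℝ) (X : Ω → Matrix ι (Fin m) 𝔸) : Prop where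
  aemeasurable : AEMeasurable X P
  map_eq : P.map X =
    (volume : Measure (Matrix ι (Fin m) 𝔸)).withDensity
      (fun x => ENNReal.ofReal (h (𝔸.dim * reTrace (xᴴ * x))))

/-- The `i`-th block `X_i` (with `n i` rows) of a matrix whose rows are partitioned into
consecutive blocks of `n 0, …, n k` rows. -/
def rowBlock {k m : ℕ} {n : Fin (k + 1) → ℕ} {𝔸 : NormedDivAlg} (i : Fin (k + 1))
    (x : Matrix (Σ i, Fin (n i)) (Fin m) 𝔸) : Matrix (Fin (n i)) (Fin m) 𝔸 :=
  x.submatrix (fun r => ⟨i, r⟩) id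

end

/-! ### Algebraic identities in the four normed division algebras -/

namespace Quaternion

/-! Both laws are push-forwards of Lebesgue measure. The density of X depends only on tr XᴴX, the
sum of the traces of the blocks XᵢᴴXᵢ, so it passes through the push-forward as a factor. Lebesgue
measure on the stacked matrix is the product over the blocks. Hence it suffices to push Lebesgue
measure on a single n × m block forward along tr XᴴX or XᴴX; `IsSpherical.map_rowBlock` does the
assembly for both parts.

The trace is the squared Euclidean norm in βnm real coordinates, so part (i) is polar coordinates
(`lintegral_norm_sq`).

For XᴴX the argument is induction on the number m of columns
(`exists_lintegral_conjTranspose_mul_self`). Appending a column x to X borders S = XᴴX by w = Xᴴx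
and b = ‖x‖². For fixed X, splitting x along ker Xᴴ and its orthogonal complement shows that (w, b)
has density const · |S|^(-β/2) (b - wᴴS⁻¹w)^(β(n-m)/2-1) on b > wᴴS⁻¹w
(`lintegral_linearMap_norm_sq`). For positive definite S, the Schur complement b - wᴴS⁻¹w is
positive exactly when the bordered matrix V is positive definite, and it then equals |V|/|S|
(`isPosDef_border_iff`, `hermDet_border`). The resulting power of |S| cancels the one supplied by
the induction hypothesis.

The constant is never tracked through the induction. Testing the identity on exp(-tr V) turns the
left side into a Gaussian integral and the right side into C · Γ_m (`map_conjTranspose_mul_self`).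

For octonions, passing from m to m + 1 columns needs Xᴴ(Xp) = (XᴴX)p and that wᴴS⁻¹w acts as a real
scalar. For m ≤ 1 both follow from the alternative law x̄(xy) = ‖x‖²y, which is where m ≤ 2 in part
(ii) comes from. -/

theorem re_mul_comm (a b : Quaternion ℝ) : (a * b).re = (b * a).re := by
  simp only [Quaternion.re_mul]
  ring

theorem star_mul_mul_self (a b : Quaternion ℝ) : star a * (a * b) = (star a * a).re • b := by
  apply Quaternion.ext <;> simp <;> ring

theorem eq_re_smul_one_of_star_eq {a : Quaternion ℝ} (h : star a = a) :
    a = a.re • (1 : Quaternion ℝ) := by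
  have h1 := congrArg (fun q : Quaternion ℝ => q.imI) h
  have h2 := congrArg (fun q : Quaternion ℝ => q.imJ) h
  have h3 := congrArg (fun q : Quaternion ℝ => q.imK) h
  simp only [Quaternion.imI_star, Quaternion.imJ_star, Quaternion.imK_star] at h1 h2 h3
  apply Quaternion.ext <;> simp <;> linarith

theorem eq_zero_of_neg_eq {a : Quaternion ℝ} (h : -a = a) : a = 0 := by
  have h0 := congrArg (fun q : Quaternion ℝ => q.re) h
  have h1 := congrArg (fun q : Quaternion ℝ => q.imI) h
  have h2 := congrArg (fun q : Quaternion ℝ => q.imJ) h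
  have h3 := congrArg (fun q : Quaternion ℝ => q.imK) h
  simp only [Quaternion.re_neg, Quaternion.imI_neg, Quaternion.imJ_neg,
    Quaternion.imK_neg] at h0 h1 h2 h3
  apply Quaternion.ext <;> simp <;> linarith

end Quaternion

namespace Octonion

theorem star_star' (x : Octonion) : star (star x) = x := by
  apply Prod.ext <;> simp

theorem star_mul' (x y : Octonion) : star (x * y) = star y * star x := by
  apply Prod.ext
  · simp
  · simp [add_comm]

theorem star_add' (x y : Octonion) : star (x + y) = star x + star y := by
  apply Prod.ext
  · simp
  · simp [add_comm]

theorem star_smul' (r : ℝ) (x : Octonion) : star (r • x) = r • star x := by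
  apply Prod.ext
  · exact Quaternion.star_smul r x.1
  · simp

theorem smul_mul' (r : ℝ) (x y : Octonion) : (r • x) * y = r • (x * y) := by
  apply Prod.ext <;> simp [smul_sub, smul_add]

/-- Octonion associators are purely imaginary; this is the associativity that survives under the
real part. -/
theorem re_mul_assoc (x y z : Octonion) :
    QuaternionAlgebra.re (x * y * z).1 = QuaternionAlgebra.re (x * (y * z)).1 := by
  simp only [mul_fst, mul_snd, Quaternion.re_mul, Quaternion.re_sub, Quaternion.re_add,
    Quaternion.imI_add, Quaternion.imJ_add, Quaternion.imK_add, Quaternion.imI_sub,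
    Quaternion.imJ_sub, Quaternion.imK_sub, Quaternion.imI_mul, Quaternion.imJ_mul,
    Quaternion.imK_mul, Quaternion.re_star, Quaternion.imI_star, Quaternion.imJ_star,
    Quaternion.imK_star]
  ring

theorem star_mul_mul_self (x y : Octonion) :
    star x * (x * y) = QuaternionAlgebra.re (star x * x).1 • y := by
  apply Prod.ext <;> apply Quaternion.ext <;>
    simp only [mul_fst, mul_snd, star_fst, star_snd, smul_fst, smul_snd, Quaternion.re_mul, Quaternion.re_sub, Quaternion.re_add,
      Quaternion.imI_add, Quaternion.imJ_add, Quaternion.imK_add, Quaternion.imI_sub,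
      Quaternion.imJ_sub, Quaternion.imK_sub, Quaternion.re_neg, Quaternion.imI_neg,
      Quaternion.imJ_neg, Quaternion.imK_neg, Quaternion.re_smul, Quaternion.imI_smul,
      Quaternion.imJ_smul, Quaternion.imK_smul, Quaternion.imI_mul, Quaternion.imJ_mul,
      Quaternion.imK_mul, Quaternion.re_star, Quaternion.imI_star, Quaternion.imJ_star,
      Quaternion.imK_star, smul_eq_mul] <;>
    ring

theorem eq_re_smul_one_of_star_eq {x : Octonion} (h : star x = x) :
    x = QuaternionAlgebra.re x.1 • (1 : Octonion) := by
  have h1 : star x.1 = x.1 := congrArg Prod.fst h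
  have h2 : -x.2 = x.2 := congrArg Prod.snd h
  apply Prod.ext
  · exact Quaternion.eq_re_smul_one_of_star_eq h1
  · simp [Quaternion.eq_zero_of_neg_eq h2]

end Octonion

/-! ### Star, scalar and real-part structure, uniformly in the algebra. -/

namespace NormedDivAlg

variable (𝔸 : NormedDivAlg)

instance instStarRing : StarRing 𝔸 where
  star_involutive := by
    cases 𝔸
    · exact star_star (R := ℝ)
    · exact star_star (R := ℂ)
    · exact star_star (R := Quaternion ℝ)
    · exact Octonion.star_star'
  star_mul := by
    cases 𝔸
    · exact star_mul (R := ℝ)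
    · exact star_mul (R := ℂ)
    · exact star_mul (R := Quaternion ℝ)
    · exact Octonion.star_mul'
  star_add := by
    cases 𝔸
    · exact star_add (R := ℝ)
    · exact star_add (R := ℂ)
    · exact star_add (R := Quaternion ℝ)
    · exact Octonion.star_add'

instance instSMulCommClass : SMulCommClass ℝ 𝔸 𝔸 where
  smul_comm r a b := (𝔸.mul_real_smul r a b).symm

instance instIsScalarTower : IsScalarTower ℝ 𝔸 𝔸 where
  smul_assoc := by
    cases 𝔸
    · exact smul_mul_assoc (α := ℝ) (β := ℝ)
    · exact smul_mul_assoc (α := ℝ) (β := ℂ)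
    · exact smul_mul_assoc (α := ℝ) (β := Quaternion ℝ)
    · exact Octonion.smul_mul'

instance instStarModule : StarModule ℝ 𝔸 where
  star_smul := by
    cases 𝔸
    · exact star_smul (R := ℝ) (A := ℝ)
    · exact star_smul (R := ℝ) (A := ℂ)
    · exact Quaternion.star_smul (R := ℝ)
    · exact Octonion.star_smul'

/-- The real part as a linear map. -/
def reₗ : 𝔸 →ₗ[ℝ] ℝ where
  toFun := 𝔸.re
  map_add' := by
    cases 𝔸
    · exact fun _ _ => rfl
    · exact fun _ _ => rfl
    · exact fun _ _ => rfl
    · exact fun _ _ => rfl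
  map_smul' := by
    cases 𝔸
    · exact fun _ _ => rfl
    · exact fun r z => Complex.smul_re r z
    · exact fun _ _ => rfl
    · exact fun _ _ => rfl

@[simp] theorem re_add (a b : 𝔸) : 𝔸.re (a + b) = 𝔸.re a + 𝔸.re b := 𝔸.reₗ.map_add a b

@[simp] theorem re_zero : 𝔸.re 0 = 0 := 𝔸.reₗ.map_zero

@[simp] theorem re_smul (r : ℝ) (a : 𝔸) : 𝔸.re (r • a) = r * 𝔸.re a := 𝔸.reₗ.map_smul r a

theorem re_sum {ι : Type*} (s : Finset ι) (f : ι → 𝔸) :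
    𝔸.re (∑ i ∈ s, f i) = ∑ i ∈ s, 𝔸.re (f i) := map_sum 𝔸.reₗ f s

@[simp] theorem re_one : 𝔸.re 1 = 1 := by
  cases 𝔸 <;> rfl

theorem re_star (a : 𝔸) : 𝔸.re (star a) = 𝔸.re a := by
  cases 𝔸
  · exact rfl
  · exact rfl
  · exact Quaternion.re_star (R := ℝ) a
  · exact Quaternion.re_star (R := ℝ) a.1

theorem re_mul_assoc (a b c : 𝔸) : 𝔸.re (a * b * c) = 𝔸.re (a * (b * c)) := by
  cases 𝔸
  · exact mul_assoc (G := ℝ) a b c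
  · exact congrArg Complex.re (mul_assoc (G := ℂ) a b c)
  · exact congrArg QuaternionAlgebra.re (mul_assoc (G := Quaternion ℝ) a b c)
  · exact Octonion.re_mul_assoc a b c

theorem _root_.Complex.star_mul_mul_self (a b : ℂ) : star a * (a * b) = (star a * a).re • b := by
  apply Complex.ext <;> simp <;> ring

theorem _root_.Complex.eq_re_smul_one_of_star_eq {a : ℂ} (h : star a = a) :
    a = a.re • (1 : ℂ) := by
  have := Complex.conj_eq_iff_im.1 h
  apply Complex.ext <;> simp [this]

theorem star_mul_mul_self (a b : 𝔸) : star a * (a * b) = 𝔸.re (star a * a) • b := by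
  cases 𝔸
  · exact (mul_assoc (G := ℝ) a a b).symm
  · exact Complex.star_mul_mul_self a b
  · exact Quaternion.star_mul_mul_self a b
  · exact Octonion.star_mul_mul_self a b

theorem eq_re_smul_one_of_star_eq {a : 𝔸} (ha : star a = a) : a = 𝔸.re a • (1 : 𝔸) := by
  cases 𝔸
  · exact (mul_one (M := ℝ) a).symm
  · exact Complex.eq_re_smul_one_of_star_eq ha
  · exact Quaternion.eq_re_smul_one_of_star_eq ha
  · exact Octonion.eq_re_smul_one_of_star_eq ha

theorem mul_assoc_of_ne_octonion (h𝔸 : 𝔸 ≠ octonion) (a b c : 𝔸) : a * b * c = a * (b * c) := by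
  cases 𝔸
  · exact mul_assoc (G := ℝ) a b c
  · exact mul_assoc (G := ℂ) a b c
  · exact mul_assoc (G := Quaternion ℝ) a b c
  · exact absurd rfl h𝔸

theorem re_star_mul_comm (a b : 𝔸) : 𝔸.re (star a * b) = 𝔸.re (star b * a) := by
  rw [← re_star, star_mul, star_star]

theorem re_star_mul_mul (a b c : 𝔸) :
    𝔸.re (star a * (b * c)) = 𝔸.re (star (star b * a) * c) := by
  rw [star_mul, star_star, re_mul_assoc]

end NormedDivAlg

/-! ### Linear images and squared norms of Lebesgue measure on Euclidean spaces -/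

section Euclidean

open Set Module
open scoped ENNReal

theorem LinearMap.det_adjoint_real {E : Type*} [NormedAddCommGroup E] [InnerProductSpace ℝ E]
    [FiniteDimensional ℝ E] (f : E →ₗ[ℝ] E) :
    LinearMap.det (LinearMap.adjoint f) = LinearMap.det f := by
  rw [← LinearMap.det_toMatrix (stdOrthonormalBasis ℝ E).toBasis,
    LinearMap.toMatrix_adjoint, Matrix.det_conjTranspose, LinearMap.det_toMatrix]
  rfl

/-- Half of the surface area of the unit sphere in `ℝ ^ d`. -/
noncomputable def halfSphereArea (d : ℕ) : ℝ≥0∞ :=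
  (volume : Measure (EuclideanSpace ℝ (Fin d))).toSphere univ / 2

theorem lintegral_Ioi_sq (u : ℝ → ℝ≥0∞) :
    ∫⁻ t in Ioi (0 : ℝ), u t = ∫⁻ r in Ioi (0 : ℝ), ENNReal.ofReal (2 * r) * u (r ^ 2) := by
  have himg : (fun r : ℝ => r ^ 2) '' Ioi 0 = Ioi 0 := by
    ext t
    constructor
    · rintro ⟨r, hr, rfl⟩
      exact pow_pos (mem_Ioi.1 hr) 2
    · intro ht
      exact ⟨√t, Real.sqrt_pos.2 ht, Real.sq_sqrt (le_of_lt ht)⟩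
  have := lintegral_image_eq_lintegral_deriv_mul_of_monotoneOn (f := fun r : ℝ => r ^ 2)
    (f' := fun r => 2 * r) measurableSet_Ioi
    (fun x _ => by simpa using (hasDerivAt_pow 2 x).hasDerivWithinAt)
    (fun a ha b _ hab => pow_le_pow_left₀ (le_of_lt ha) hab 2) u
  rwa [himg] at this

/-- Polar coordinates followed by t = r²: here r^(d-1) dr = ½ t^(d/2-1) dt, which is why half of the
sphere area appears. -/
theorem lintegral_norm_sq_euclideanSpace {d : ℕ} (hd : 0 < d) {f : ℝ → ℝ≥0∞} (hf : Measurable f) :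
    ∫⁻ z : EuclideanSpace ℝ (Fin d), f (‖z‖ ^ 2) =
      halfSphereArea d *
        ∫⁻ t in Ioi (0 : ℝ), ENNReal.ofReal (t ^ ((d : ℝ) / 2 - 1)) * f t := by
  have : Nonempty (Fin d) := ⟨⟨0, hd⟩⟩
  set μ : Measure (EuclideanSpace ℝ (Fin d)) := volume with hμ
  have hdim : finrank ℝ (EuclideanSpace ℝ (Fin d)) = d := by simp
  have h1 : ∫⁻ z, f (‖z‖ ^ 2) ∂μ =
      ∫⁻ z : ({(0)}ᶜ : Set (EuclideanSpace ℝ (Fin d))), f (‖z.1‖ ^ 2) ∂(μ.comap (↑)) := by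
    rw [lintegral_subtype_comap (measurableSet_singleton _).compl fun x => f (‖x‖ ^ 2),
      restrict_compl_singleton]
  have h2 : ∫⁻ z : ({(0)}ᶜ : Set (EuclideanSpace ℝ (Fin d))), f (‖z.1‖ ^ 2) ∂(μ.comap (↑)) =
      ∫⁻ x, f ((x.2 : ℝ) ^ 2) ∂μ.toSphere.prod (.volumeIoiPow (d - 1)) := by
    have := μ.measurePreserving_homeomorphUnitSphereProd.lintegral_comp_emb
      (Homeomorph.measurableEmbedding _) (fun x => f ((x.2 : ℝ) ^ 2))
    rw [hdim] at this
    simpa using this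
  have h3 : ∫⁻ x, f ((x.2 : ℝ) ^ 2) ∂μ.toSphere.prod (.volumeIoiPow (d - 1)) =
      μ.toSphere univ * ∫⁻ r : Ioi (0 : ℝ), f ((r : ℝ) ^ 2) ∂.volumeIoiPow (d - 1) := by
    rw [lintegral_prod _ (by fun_prop)]
    simp [mul_comm]
  have h4 : ∫⁻ r : Ioi (0 : ℝ), f ((r : ℝ) ^ 2) ∂.volumeIoiPow (d - 1) =
      ∫⁻ r in Ioi (0 : ℝ), ENNReal.ofReal (r ^ (d - 1)) * f (r ^ 2) := by
    rw [Measure.volumeIoiPow, lintegral_withDensity_eq_lintegral_mul _ (by fun_prop) (by fun_prop)]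
    exact lintegral_subtype_comap measurableSet_Ioi
      fun r : ℝ => ENNReal.ofReal (r ^ (d - 1)) * f (r ^ 2)
  have h5 : ∫⁻ t in Ioi (0 : ℝ), ENNReal.ofReal (t ^ ((d : ℝ) / 2 - 1)) * f t =
      2 * ∫⁻ r in Ioi (0 : ℝ), ENNReal.ofReal (r ^ (d - 1)) * f (r ^ 2) := by
    rw [lintegral_Ioi_sq, ← lintegral_const_mul _ (by fun_prop)]
    refine setLIntegral_congr_fun measurableSet_Ioi fun r hr => ?_
    have hr : 0 < r := hr
    have e1 : (r ^ 2) ^ ((d : ℝ) / 2 - 1) * r = r ^ (d - 1) := by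
      rw [← Real.rpow_natCast r 2, ← Real.rpow_mul hr.le, ← Real.rpow_natCast r (d - 1),
        Nat.cast_sub hd]
      nth_rewrite 2 [← Real.rpow_one r]
      rw [← Real.rpow_add hr]
      congr 1
      push_cast
      ring
    simp only [← mul_assoc]
    congr 1
    rw [ENNReal.ofReal_mul zero_le_two, ENNReal.ofReal_ofNat, mul_assoc,
      ← ENNReal.ofReal_mul hr.le, ← e1, mul_comm r]
  rw [h1, h2, h3, h4, h5, halfSphereArea, ← hμ, ← mul_assoc,
    ENNReal.div_mul_cancel two_ne_zero ENNReal.ofNat_ne_top]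

variable {E F : Type*} [NormedAddCommGroup E] [InnerProductSpace ℝ E] [FiniteDimensional ℝ E]
  [MeasurableSpace E] [BorelSpace E] [NormedAddCommGroup F] [InnerProductSpace ℝ F]
  [FiniteDimensional ℝ F] [MeasurableSpace F] [BorelSpace F]

theorem lintegral_norm_sq {d : ℕ} (hE : finrank ℝ E = d) (hd : 0 < d) {f : ℝ → ℝ≥0∞}
    (hf : Measurable f) :
    ∫⁻ z : E, f (‖z‖ ^ 2) =
      halfSphereArea d *
        ∫⁻ t in Ioi (0 : ℝ), ENNReal.ofReal (t ^ ((d : ℝ) / 2 - 1)) * f t := by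
  subst hE
  rw [← lintegral_norm_sq_euclideanSpace hd hf,
    ← (stdOrthonormalBasis ℝ E).repr.measurePreserving.lintegral_comp (by fun_prop)]
  simp

theorem lintegral_orthogonalDecomposition (K : Submodule ℝ E) {f : E → ℝ≥0∞} (hf : Measurable f) :
    ∫⁻ x, f x = ∫⁻ y : Kᗮ, ∫⁻ z : K, f (z + y) := by
  have h : MeasurePreserving (fun p : K × Kᗮ => (p.1 + p.2 : E))
      (volume : Measure (K × Kᗮ)) volume := by
    have := K.orthogonalDecomposition.symm.measurePreserving.comp
      (WithLp.volume_preserving_toLp K Kᗮ)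
    convert! this using 1
  rw [← h.lintegral_comp hf, Measure.volume_eq_prod]
  exact lintegral_prod_symm _ ((hf.comp h.measurable).aemeasurable)

/-- Write x = z + y with z in ker T and y orthogonal to it. Then T x depends on y alone and is a
linear isomorphism there, while ‖x‖² = ‖z‖² + ‖y‖², and polar coordinates apply to z in the
d-dimensional kernel. Since `u` inverts T T*, the number ⟨w, u w⟩ is the squared norm of the
shortest preimage of w, so ‖z‖² = b - ⟨w, u w⟩. -/
theorem lintegral_linearMap_norm_sq {d : ℕ} (hdim : finrank ℝ E = finrank ℝ F + d) (hd : 0 < d)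
    (T : E →ₗ[ℝ] F) {u : F → F} (hu : ∀ w, T (LinearMap.adjoint T (u w)) = w)
    (hum : Measurable u)
    {g : F × ℝ → ℝ≥0∞} (hg : Measurable g) :
    ∫⁻ x, g (T x, ‖x‖ ^ 2) =
      halfSphereArea d *
        ENNReal.ofReal (LinearMap.det (T ∘ₗ LinearMap.adjoint T) ^ (-(1 / 2) : ℝ)) *
        ∫⁻ w, ∫⁻ b in Ioi (inner ℝ w (u w)),
          ENNReal.ofReal ((b - inner ℝ w (u w)) ^ ((d : ℝ) / 2 - 1)) * g (w, b) := by
  have hsurj : Function.Surjective T := fun w => ⟨_, hu w⟩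
  set K := LinearMap.ker T with hK
  have hKdim : finrank ℝ K = d := by
    have h1 := T.finrank_range_add_finrank_ker
    rw [LinearMap.range_eq_top.2 hsurj, finrank_top, ← hK] at h1
    omega
  have hKo : finrank ℝ F = finrank ℝ Kᗮ := by
    have := K.finrank_add_finrank_orthogonal
    omega
  -- Any isometry F ≃ (ker T)ᗮ makes T restricted to (ker T)ᗮ an endomorphism M of F. It then has a
  -- determinant, and M M* = T T* gives |det M| = det(T T*)^(1/2).
  let A : F ≃ₗᵢ[ℝ] Kᗮ := (stdOrthonormalBasis ℝ F).equiv (stdOrthonormalBasis ℝ Kᗮ) (finCongr hKo)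
  let M : F →ₗ[ℝ] F := T ∘ₗ Kᗮ.subtype ∘ₗ A.toLinearEquiv.toLinearMap
  have hM (y : F) : M y = T (A y) := rfl
  have hTK (v : F) : LinearMap.adjoint T v ∈ Kᗮ := by
    intro x hx
    rw [LinearMap.adjoint_inner_right, LinearMap.mem_ker.1 hx, inner_zero_left]
  have hMadj (v : F) : LinearMap.adjoint M v = A.symm ⟨LinearMap.adjoint T v, hTK v⟩ := by
    refine ext_inner_right ℝ fun y => ?_
    rw [LinearMap.adjoint_inner_left, hM, ← LinearMap.adjoint_inner_left, ← A.inner_map_map,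
      A.apply_symm_apply]
    rfl
  have hMM (v : F) : M (LinearMap.adjoint M v) = T (LinearMap.adjoint T v) := by
    rw [hMadj, hM, A.apply_symm_apply]
  have hMsurj : Function.Surjective M := fun w => ⟨_, (hMM (u w)).trans (hu w)⟩
  have hMinj : Function.Injective M := LinearMap.injective_iff_surjective.2 hMsurj
  have hdet : LinearMap.det M ≠ 0 :=
    (LinearEquiv.isUnit_det' (LinearEquiv.ofBijective M ⟨hMinj, hMsurj⟩)).ne_zero
  have hdet2 : LinearMap.det (T ∘ₗ LinearMap.adjoint T) = LinearMap.det M ^ 2 := by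
    have : T ∘ₗ LinearMap.adjoint T = M ∘ₗ LinearMap.adjoint M :=
      LinearMap.ext fun v => (hMM v).symm
    rw [this, LinearMap.det_comp, LinearMap.det_adjoint_real, sq]
  have hq (y : F) : inner ℝ (M y) (u (M y)) = ‖y‖ ^ 2 := by
    have : LinearMap.adjoint M (u (M y)) = y := hMinj ((hMM _).trans (hu _))
    rw [← LinearMap.adjoint_inner_right, this, real_inner_self_eq_norm_sq]
  have hTm : Measurable T := T.continuous_of_finiteDimensional.measurable
  have hMm : Measurable M := M.continuous_of_finiteDimensional.measurable
  set q : F → ℝ := fun w => inner ℝ w (u w) with hq_def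
  have hqm : Measurable q := by fun_prop
  let φ : F → ℝ≥0∞ := fun w =>
    ∫⁻ t in Ioi (0 : ℝ), ENNReal.ofReal (t ^ ((d : ℝ) / 2 - 1)) * g (w, t + q w)
  have hφm : Measurable φ := by
    refine Measurable.lintegral_prod_right' (f := fun p : F × ℝ =>
      ENNReal.ofReal (p.2 ^ ((d : ℝ) / 2 - 1)) * g (p.1, p.2 + q p.1)) ?_
    fun_prop
  have e1 : ∫⁻ x, g (T x, ‖x‖ ^ 2) = ∫⁻ y : F, ∫⁻ z : K, g (M y, ‖z‖ ^ 2 + ‖y‖ ^ 2) := by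
    rw [lintegral_orthogonalDecomposition K (by fun_prop), ← A.measurePreserving.lintegral_comp]
    · refine lintegral_congr fun y => lintegral_congr fun z => ?_
      have hz : T z = 0 := z.2
      have hn : ‖(z : E) + A y‖ ^ 2 = ‖z‖ ^ 2 + ‖y‖ ^ 2 := by
        have h0 : inner ℝ (z : E) (A y : E) = 0 := (A y).2 z z.2
        have h1 := norm_add_sq_real (z : E) (A y)
        rw [h0] at h1
        rw [h1, ← Submodule.coe_norm, ← Submodule.coe_norm, A.norm_map]
        ring
      rw [map_add, hz, zero_add, hn, hM]
    · refine Measurable.lintegral_prod_right' (f := fun p : Kᗮ × K =>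
        g (T (p.2 + p.1), ‖(p.2 + p.1 : E)‖ ^ 2)) ?_
      fun_prop
  have e2 (y : F) : ∫⁻ z : K, g (M y, ‖z‖ ^ 2 + ‖y‖ ^ 2) = halfSphereArea d * φ (M y) := by
    rw [lintegral_norm_sq hKdim hd (f := fun t => g (M y, t + ‖y‖ ^ 2)) (by fun_prop)]
    simp only [φ, q, hq]
  have e3 : ∫⁻ y, φ (M y) = ENNReal.ofReal |(LinearMap.det M)⁻¹| * ∫⁻ w, φ w := by
    rw [← lintegral_map hφm hMm, Measure.map_linearMap_addHaar_eq_smul_addHaar _ hdet,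
      lintegral_smul_measure, smul_eq_mul]
  have e4 (w : F) : φ w = ∫⁻ b in Ioi (q w),
      ENNReal.ofReal ((b - q w) ^ ((d : ℝ) / 2 - 1)) * g (w, b) := by
    have := (measurePreserving_add_right volume (q w)).setLIntegral_comp_preimage
      (s := Ioi (q w)) measurableSet_Ioi
      (f := fun b => ENNReal.ofReal ((b - q w) ^ ((d : ℝ) / 2 - 1)) * g (w, b)) (by fun_prop)
    rw [← this]
    simp [φ]
  have e5 : |(LinearMap.det M)⁻¹| = LinearMap.det (T ∘ₗ LinearMap.adjoint T) ^ (-(1 / 2) : ℝ) := by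
    rw [hdet2, Real.rpow_neg (sq_nonneg _), ← Real.sqrt_eq_rpow, Real.sqrt_sq_eq_abs, abs_inv]
  rw [e1, lintegral_congr e2, lintegral_const_mul _ (by fun_prop), e3, e5, lintegral_congr e4,
    mul_assoc]

end Euclidean

/-! ### Measure preserving orthonormal coordinates -/

/-- Linear coordinates on `V` which turn a bilinear form into the Euclidean inner product and the
given measure into Lebesgue measure. -/
structure OrthoCoords (V : Type*) [AddCommGroup V] [Module ℝ V] [MeasureSpace V]
    (ι : Type*) [Fintype ι] (B : V → V → ℝ) where
  /-- The coordinate map. -/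
  equiv : V ≃ₗ[ℝ] EuclideanSpace ℝ ι
  measurePreserving : MeasurePreserving equiv volume volume
  measurable_symm : Measurable equiv.symm
  inner_eq : ∀ x y, inner ℝ (equiv x) (equiv y) = B x y

/-- Serves both to flatten matrix entries into real coordinates and to cut the rows of a matrix into
blocks. -/
theorem measurePreserving_piCurry_symm {ι : Type*} [Fintype ι] {κ : ι → Type*}
    [∀ i, Fintype (κ i)] (X : (i : ι) → κ i → Type*) [∀ i j, MeasureSpace (X i j)]
    [∀ i j, SigmaFinite (volume : Measure (X i j))] :
    MeasurePreserving (MeasurableEquiv.piCurry X).symm volume volume := by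
  refine ⟨(MeasurableEquiv.piCurry X).symm.measurable, ?_⟩
  refine (Measure.pi_eq fun s hs => ?_).symm
  rw [MeasurableEquiv.map_apply]
  have : (MeasurableEquiv.piCurry X).symm ⁻¹' (Set.univ.pi s) =
      Set.univ.pi fun i => Set.univ.pi fun j => s ⟨i, j⟩ := by
    ext x
    simp only [MeasurableEquiv.coe_piCurry_symm, Set.mem_preimage, Set.mem_univ_pi]
    exact ⟨fun h i j => h ⟨i, j⟩, fun h p => h p.1 p.2⟩
  rw [this, volume_pi_pi]
  simp_rw [volume_pi_pi]
  rw [Fintype.prod_sigma]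

namespace OrthoCoords

open Module
open scoped ENNReal

variable {V W : Type*} [AddCommGroup V] [Module ℝ V] [MeasureSpace V] [AddCommGroup W]
  [Module ℝ W] [MeasureSpace W] {ι κ : Type*} [Fintype ι] [Fintype κ] {B : V → V → ℝ}
  {C : W → W → ℝ}

theorem self_eq_norm_sq (e : OrthoCoords V ι B) (x : V) : B x x = ‖e.equiv x‖ ^ 2 := by
  rw [← e.inner_eq, real_inner_self_eq_norm_sq]

theorem measurable (e : OrthoCoords V ι B) : Measurable e.equiv := e.measurePreserving.measurable

theorem measurable_linearMap (e : OrthoCoords V ι B) (e' : OrthoCoords W κ C) (T : V →ₗ[ℝ] W) :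
    Measurable T := by
  have h : Measurable (e'.equiv.toLinearMap ∘ₗ T ∘ₗ e.equiv.symm.toLinearMap) :=
    (LinearMap.continuous_of_finiteDimensional _).measurable
  have := e'.measurable_symm.comp (h.comp e.measurable)
  convert! this using 1
  ext x
  simp

theorem sigmaFinite (e : OrthoCoords V ι B) : SigmaFinite (volume : Measure V) := by
  have : SigmaFinite ((volume : Measure V).map e.equiv) := by
    rw [e.measurePreserving.map_eq]
    infer_instance
  exact this.of_map _ e.measurable.aemeasurable

/-- Coordinates of a finite-dimensional inner product space. -/
noncomputable def ofInnerProductSpace (E : Type*) [NormedAddCommGroup E] [InnerProductSpace ℝ E]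
    [FiniteDimensional ℝ E] [MeasurableSpace E] [BorelSpace E] {d : ℕ} (hd : finrank ℝ E = d) :
    OrthoCoords E (Fin d) (fun x y => inner ℝ x y) where
  equiv := ((stdOrthonormalBasis ℝ E).reindex (finCongr hd)).repr.toLinearEquiv
  measurePreserving := ((stdOrthonormalBasis ℝ E).reindex (finCongr hd)).measurePreserving_repr
  measurable_symm :=
    ((stdOrthonormalBasis ℝ E).reindex (finCongr hd)).repr.symm.continuous.measurable
  inner_eq x y := ((stdOrthonormalBasis ℝ E).reindex (finCongr hd)).repr.inner_map_map x y

/-- Coordinates of a product of two inner product spaces. -/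
noncomputable def ofProd (E F : Type*) [NormedAddCommGroup E] [InnerProductSpace ℝ E]
    [FiniteDimensional ℝ E] [MeasurableSpace E] [BorelSpace E] [NormedAddCommGroup F]
    [InnerProductSpace ℝ F] [FiniteDimensional ℝ F] [MeasurableSpace F] [BorelSpace F] {d : ℕ}
    (hd : finrank ℝ (WithLp 2 (E × F)) = d) :
    @OrthoCoords (E × F) _ _ Measure.prod.measureSpace (Fin d) _
      (fun x y => inner ℝ x.1 y.1 + inner ℝ x.2 y.2) :=
  letI e := ofInnerProductSpace (WithLp 2 (E × F)) hd
  { equiv := (WithLp.linearEquiv 2 ℝ (E × F)).symm ≪≫ₗ e.equiv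
    measurePreserving := e.measurePreserving.comp (WithLp.volume_preserving_toLp E F)
    measurable_symm := (WithLp.measurable_ofLp 2 _).comp e.measurable_symm
    inner_eq := fun x y => by
      refine (e.inner_eq _ _).trans ?_
      simp [WithLp.prod_inner_apply] }

/-- Coordinates of a finite power. -/
noncomputable def pi (e : OrthoCoords V ι B) (n : Type*) [Fintype n] :
    OrthoCoords (n → V) (Σ _ : n, ι) (fun x y => ∑ i, B (x i) (y i)) where
  equiv := LinearEquiv.piCongrRight (fun _ => e.equiv ≪≫ₗ WithLp.linearEquiv 2 ℝ (ι → ℝ)) ≪≫ₗ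
    (LinearEquiv.piCurry ℝ (fun (_ : n) (_ : ι) => ℝ)).symm ≪≫ₗ
      (WithLp.linearEquiv 2 ℝ ((Σ _ : n, ι) → ℝ)).symm
  measurePreserving := by
    have := e.sigmaFinite
    exact (PiLp.volume_preserving_toLp _).comp
      ((measurePreserving_piCurry_symm (fun (_ : n) (_ : ι) => ℝ)).comp
        (volume_preserving_pi (fun (_ : n) =>
          (PiLp.volume_preserving_ofLp ι).comp e.measurePreserving)))
  measurable_symm := by
    refine measurable_pi_lambda _ fun i => e.measurable_symm.comp ?_
    refine (WithLp.measurable_toLp 2 _).comp (measurable_pi_lambda _ fun j => ?_)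
    exact (measurable_pi_apply (⟨i, j⟩ : Σ _ : n, ι)).comp (WithLp.measurable_ofLp 2 _)
  inner_eq x y := by
    simp only [← e.inner_eq, PiLp.inner_apply]
    rw [Fintype.sum_sigma]
    rfl

/-- Here `S` is the adjoint of `T` for the forms `B` and `C`. In coordinates it becomes the
Euclidean adjoint, and conjugation does not change det(T ∘ S). -/
theorem lintegral_linearMap_self (e : OrthoCoords V ι B) (e' : OrthoCoords W κ C) {d : ℕ}
    (hcard : Fintype.card ι = Fintype.card κ + d) (hd : 0 < d) (T : V →ₗ[ℝ] W) (S : W →ₗ[ℝ] V)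
    (hTS : ∀ w v, C w (T v) = B (S w) v) {u : W → W} (hu : ∀ w, T (S (u w)) = w)
    (hum : Measurable u) {g : W × ℝ → ℝ≥0∞} (hg : Measurable g) :
    ∫⁻ x, g (T x, B x x) =
      halfSphereArea d * ENNReal.ofReal (LinearMap.det (T ∘ₗ S) ^ (-(1 / 2) : ℝ)) *
        ∫⁻ w, ∫⁻ b in Set.Ioi (C w (u w)),
          ENNReal.ofReal ((b - C w (u w)) ^ ((d : ℝ) / 2 - 1)) * g (w, b) := by
  set T' : EuclideanSpace ℝ ι →ₗ[ℝ] EuclideanSpace ℝ κ :=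
    e'.equiv.toLinearMap ∘ₗ T ∘ₗ e.equiv.symm.toLinearMap with hT'
  have hadj : LinearMap.adjoint T' =
      e.equiv.toLinearMap ∘ₗ S ∘ₗ e'.equiv.symm.toLinearMap := by
    symm
    rw [LinearMap.eq_adjoint_iff]
    intro w v
    obtain ⟨w, rfl⟩ := e'.equiv.surjective w
    obtain ⟨v, rfl⟩ := e.equiv.surjective v
    simp [hT', e.inner_eq, e'.inner_eq, hTS]
  have hcomp : T' ∘ₗ LinearMap.adjoint T' =
      e'.equiv.toLinearMap ∘ₗ (T ∘ₗ S) ∘ₗ e'.equiv.symm.toLinearMap := by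
    rw [hadj]
    ext1 w
    simp [hT']
  have key := lintegral_linearMap_norm_sq (E := EuclideanSpace ℝ ι) (F := EuclideanSpace ℝ κ)
    (d := d) (by simpa using hcard) hd T' (u := fun w => e'.equiv (u (e'.equiv.symm w)))
    (fun w => by
      have := congrArg (fun f : _ →ₗ[ℝ] _ => f (e'.equiv (u (e'.equiv.symm w)))) hcomp
      refine Eq.trans this ?_
      simp [hu])
    (e'.measurable.comp (hum.comp e'.measurable_symm))
    (g := fun p => g (e'.equiv.symm p.1, p.2))
    (hg.comp ((e'.measurable_symm.comp measurable_fst).prodMk measurable_snd))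
  rw [hcomp, LinearMap.det_conj] at key
  have h1 : ∫⁻ x, g (T x, B x x) =
      ∫⁻ x, g (e'.equiv.symm (T' x), ‖x‖ ^ 2) := by
    rw [← e.measurePreserving.lintegral_comp]
    · simp [hT', e.self_eq_norm_sq]
    · exact hg.comp ((e'.measurable_symm.comp
        (LinearMap.continuous_of_finiteDimensional T').measurable).prodMk (by fun_prop))
  rw [h1, key, ← e'.measurePreserving.lintegral_comp_emb (MeasurableEquiv.measurableEmbedding
    ⟨e'.equiv.toEquiv, e'.measurable, e'.measurable_symm⟩)]
  simp [e'.inner_eq]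

end OrthoCoords

/-! ### Orthonormal coordinates and measurable operations on the four algebras. -/

namespace NormedDivAlg

open Module

theorem finrank_withLp_prod_quaternion :
    finrank ℝ (WithLp 2 (Quaternion ℝ × Quaternion ℝ)) = 8 := by
  rw [LinearEquiv.finrank_eq (WithLp.linearEquiv 2 ℝ (Quaternion ℝ × Quaternion ℝ)),
    finrank_prod, Quaternion.finrank_eq_four]

theorem _root_.Quaternion.inner_eq_re_star_mul (a b : Quaternion ℝ) :
    inner ℝ a b = (star a * b).re := by
  rw [real_inner_comm, Quaternion.inner_def, Quaternion.re_mul_comm]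

theorem _root_.Octonion.inner_add_inner (x y : Octonion) :
    inner ℝ x.1 y.1 + inner ℝ x.2 y.2 = QuaternionAlgebra.re (star x * y).1 := by
  rw [Quaternion.inner_eq_re_star_mul, real_inner_comm, Quaternion.inner_eq_re_star_mul,
    Octonion.mul_fst, Octonion.star_fst, Octonion.star_snd, mul_neg, sub_neg_eq_add,
    Quaternion.re_add]

/-- Orthonormal coordinates on a normed division algebra. -/
noncomputable def coords : (𝔸 : NormedDivAlg) →
    OrthoCoords 𝔸 (Fin 𝔸.dim) (fun x y => 𝔸.re (star x * y))
  | real =>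
    { OrthoCoords.ofInnerProductSpace ℝ (finrank_self ℝ) with
      inner_eq := fun x y => (OrthoCoords.inner_eq _ x y).trans (mul_comm (G := ℝ) y x) }
  | complex =>
    { OrthoCoords.ofInnerProductSpace ℂ Complex.finrank_real_complex with
      inner_eq := fun x y => (OrthoCoords.inner_eq _ x y).trans
        (congrArg Complex.re (mul_comm (G := ℂ) y (star (x : ℂ)))) }
  | quaternion =>
    { OrthoCoords.ofInnerProductSpace (Quaternion ℝ) Quaternion.finrank_eq_four with
      inner_eq := fun x y => (OrthoCoords.inner_eq _ x y).trans
        (Quaternion.inner_eq_re_star_mul x y) }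
  | octonion =>
    { OrthoCoords.ofProd (Quaternion ℝ) (Quaternion ℝ) finrank_withLp_prod_quaternion with
      inner_eq := fun x y => (OrthoCoords.inner_eq _ x y).trans (Octonion.inner_add_inner x y) }

instance instSigmaFinite (𝔸 : NormedDivAlg) : SigmaFinite (volume : Measure 𝔸) :=
  𝔸.coords.sigmaFinite

instance instMeasurableAdd₂ : (𝔸 : NormedDivAlg) → MeasurableAdd₂ 𝔸
  | real => inferInstanceAs (MeasurableAdd₂ ℝ)
  | complex => inferInstanceAs (MeasurableAdd₂ ℂ)
  | quaternion => inferInstanceAs (MeasurableAdd₂ (Quaternion ℝ))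
  | octonion => inferInstanceAs (MeasurableAdd₂ (Quaternion ℝ × Quaternion ℝ))

theorem _root_.Octonion.measurable_mul :
    Measurable fun p : (Quaternion ℝ × Quaternion ℝ) × (Quaternion ℝ × Quaternion ℝ) =>
      (p.1.1 * p.2.1 - star p.2.2 * p.1.2, p.2.2 * p.1.1 + p.1.2 * star p.2.1) :=
  Continuous.measurable (by fun_prop)

instance instMeasurableMul₂ : (𝔸 : NormedDivAlg) → MeasurableMul₂ 𝔸
  | real => inferInstanceAs (MeasurableMul₂ ℝ)
  | complex => inferInstanceAs (MeasurableMul₂ ℂ)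
  | quaternion => inferInstanceAs (MeasurableMul₂ (Quaternion ℝ))
  | octonion => ⟨Octonion.measurable_mul⟩

theorem _root_.Octonion.measurable_smul :
    Measurable fun p : ℝ × (Quaternion ℝ × Quaternion ℝ) => p.1 • p.2 :=
  Continuous.measurable (by fun_prop)

instance instMeasurableSMul₂ : (𝔸 : NormedDivAlg) → MeasurableSMul₂ ℝ 𝔸
  | real => inferInstanceAs (MeasurableSMul₂ ℝ ℝ)
  | complex => inferInstanceAs (MeasurableSMul₂ ℝ ℂ)
  | quaternion => inferInstanceAs (MeasurableSMul₂ ℝ (Quaternion ℝ))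
  | octonion => ⟨Octonion.measurable_smul⟩

theorem measurable_star (𝔸 : NormedDivAlg) : Measurable (star : 𝔸 → 𝔸) :=
  𝔸.coords.measurable_linearMap 𝔸.coords
    { toFun := star, map_add' := star_add, map_smul' := fun r x => by simp }

theorem measurable_re (𝔸 : NormedDivAlg) : Measurable 𝔸.re :=
  𝔸.coords.measurable_linearMap (OrthoCoords.ofInnerProductSpace ℝ (finrank_self ℝ)) 𝔸.reₗ

end NormedDivAlg

/-! ### Bordered Hermitian matrices and Schur complements -/

namespace NormedDivAlg

instance instFinite (𝔸 : NormedDivAlg) : Module.Finite ℝ 𝔸 :=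
  Module.Finite.equiv 𝔸.coords.equiv.symm

theorem finrank_eq_dim (𝔸 : NormedDivAlg) : Module.finrank ℝ 𝔸 = 𝔸.dim := by
  rw [𝔸.coords.equiv.finrank_eq]
  simp

theorem dim_pos (𝔸 : NormedDivAlg) : 0 < 𝔸.dim := by
  cases 𝔸 <;> simp [dim]

theorem re_star_mul_self_nonneg (𝔸 : NormedDivAlg) (a : 𝔸) : 0 ≤ 𝔸.re (star a * a) := by
  rw [𝔸.coords.self_eq_norm_sq a]
  positivity

theorem re_star_mul_self_eq_zero (𝔸 : NormedDivAlg) {a : 𝔸} : 𝔸.re (star a * a) = 0 ↔ a = 0 := by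
  rw [𝔸.coords.self_eq_norm_sq a]
  simp

theorem re_star_mul_self_pos (𝔸 : NormedDivAlg) {a : 𝔸} (ha : a ≠ 0) : 0 < 𝔸.re (star a * a) :=
  lt_of_le_of_ne (𝔸.re_star_mul_self_nonneg a) fun h => ha (𝔸.re_star_mul_self_eq_zero.1 h.symm)

end NormedDivAlg

section Algebra

variable {𝔸 : NormedDivAlg} {m n : ℕ}

theorem re_star_dotProduct (p q : Fin m → 𝔸) :
    𝔸.re (star p ⬝ᵥ q) = ∑ i, 𝔸.re (star (p i) * q i) := by
  simp [dotProduct, NormedDivAlg.re_sum]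

theorem re_star_dotProduct_comm (p q : Fin m → 𝔸) :
    𝔸.re (star p ⬝ᵥ q) = 𝔸.re (star q ⬝ᵥ p) := by
  simp only [re_star_dotProduct]
  exact Finset.sum_congr rfl fun i _ => 𝔸.re_star_mul_comm _ _

/-- Only associativity under the real part enters, so Xᴴ is the real adjoint of X for octonions of
any size too. -/
theorem re_star_dotProduct_mulVec (X : Matrix (Fin n) (Fin m) 𝔸) (p : Fin n → 𝔸) (q : Fin m → 𝔸) :
    𝔸.re (star p ⬝ᵥ (X *ᵥ q)) = 𝔸.re (star (Xᴴ *ᵥ p) ⬝ᵥ q) := by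
  simp only [Pi.star_apply, Matrix.mulVec, dotProduct, Finset.mul_sum, star_sum,
    Finset.sum_mul, NormedDivAlg.re_sum, Matrix.conjTranspose_apply]
  rw [Finset.sum_comm]
  exact Finset.sum_congr rfl fun j _ => Finset.sum_congr rfl fun i _ => 𝔸.re_star_mul_mul _ _ _

/-- The real-linear operator `p ↦ X p` from columns to columns. -/
noncomputable def mulVecRealRect (X : Matrix (Fin n) (Fin m) 𝔸) : (Fin m → 𝔸) →ₗ[ℝ] (Fin n → 𝔸) where
  toFun p := X *ᵥ p
  map_add' p q := Matrix.mulVec_add X p q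
  map_smul' r p := Matrix.mulVec_smul X r p

/-- With a single octonionic column, j = l, and the left alternative law replaces associativity. -/
theorem star_mul_mul_entry (h : 𝔸 = .octonion → m ≤ 1) (X : Matrix (Fin n) (Fin m) 𝔸)
    (i : Fin n) (j l : Fin m) (a : 𝔸) :
    star (X i j) * (X i l * a) = star (X i j) * X i l * a := by
  by_cases h𝔸 : 𝔸 = .octonion
  · have := Fin.subsingleton_iff_le_one.2 (h h𝔸)
    have h1 := 𝔸.star_mul_mul_self (X i l) 1
    rw [mul_one] at h1
    rw [Subsingleton.elim j l, 𝔸.star_mul_mul_self, h1]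
    simp
  · exact (𝔸.mul_assoc_of_ne_octonion h𝔸 _ _ _).symm

theorem conjTranspose_mulVec_mulVec (h : 𝔸 = .octonion → m ≤ 1) (X : Matrix (Fin n) (Fin m) 𝔸)
    (p : Fin m → 𝔸) : Xᴴ *ᵥ (X *ᵥ p) = (Xᴴ * X) *ᵥ p := by
  ext j
  simp only [Matrix.mulVec, dotProduct, Matrix.mul_apply, Finset.mul_sum, Finset.sum_mul,
    Matrix.conjTranspose_apply]
  rw [Finset.sum_comm]
  exact Finset.sum_congr rfl fun l _ => Finset.sum_congr rfl fun i _ => star_mul_mul_entry h X i j l _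

theorem diag_eq_smul_one {S : Matrix (Fin m) (Fin m) 𝔸} (hS : Sᴴ = S) (i : Fin m) :
    S i i = 𝔸.re (S i i) • (1 : 𝔸) :=
  𝔸.eq_re_smul_one_of_star_eq (congrFun (congrFun hS i) i)

theorem mulVec_mul_right (h : 𝔸 = .octonion → m ≤ 1) {S : Matrix (Fin m) (Fin m) 𝔸} (hS : Sᴴ = S)
    (u : Fin m → 𝔸) (t : 𝔸) : S *ᵥ (fun i => u i * t) = fun i => (S *ᵥ u) i * t := by
  ext i
  simp only [Matrix.mulVec, dotProduct, Finset.sum_mul]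
  refine Finset.sum_congr rfl fun j _ => ?_
  by_cases h𝔸 : 𝔸 = .octonion
  · have := Fin.subsingleton_iff_le_one.2 (h h𝔸)
    rw [Subsingleton.elim i j, diag_eq_smul_one hS]
    simp [smul_mul_assoc]
  · exact (𝔸.mul_assoc_of_ne_octonion h𝔸 _ _ _).symm

/-- In the associative case uᴴSu equals its own conjugate, hence is real, and t factors out. For
octonions S is at most 1 × 1 with real entry, and alternativity suffices. With w = Su this makes
wᴴS⁻¹w a real scalar, so that the Schur complement is a number. -/
theorem star_mulVec_dotProduct_mul_right (h : 𝔸 = .octonion → m ≤ 1)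
    {S : Matrix (Fin m) (Fin m) 𝔸} (hS : Sᴴ = S) (u : Fin m → 𝔸) (t : 𝔸) :
    star (S *ᵥ u) ⬝ᵥ (fun i => u i * t) = 𝔸.re (star (S *ᵥ u) ⬝ᵥ u) • t := by
  have hSji (i j : Fin m) : star (S i j) = S j i := congrFun (congrFun hS j) i
  by_cases h𝔸 : 𝔸 = .octonion
  · have := Fin.subsingleton_iff_le_one.2 (h h𝔸)
    have hSu (i : Fin m) : (S *ᵥ u) i = 𝔸.re (S i i) • u i := by
      rw [Matrix.mulVec, dotProduct, Fintype.sum_subsingleton _ i]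
      nth_rewrite 1 [diag_eq_smul_one hS]
      simp [smul_mul_assoc]
    rw [re_star_dotProduct, dotProduct, Finset.sum_smul]
    refine Finset.sum_congr rfl fun i _ => ?_
    simp [hSu, smul_mul_assoc, 𝔸.star_mul_mul_self, mul_smul]
  · have hassoc := 𝔸.mul_assoc_of_ne_octonion h𝔸
    have h1 : star (S *ᵥ u) ⬝ᵥ (fun i => u i * t) = (star (S *ᵥ u) ⬝ᵥ u) * t := by
      simp only [dotProduct, Finset.sum_mul, hassoc]
    have h2 : star (star (S *ᵥ u) ⬝ᵥ u) = star (S *ᵥ u) ⬝ᵥ u := by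
      simp only [dotProduct, Matrix.mulVec, Pi.star_apply, star_sum, star_mul, star_star,
        Finset.sum_mul, hSji, hassoc]
      exact Finset.sum_comm
    rw [h1, 𝔸.eq_re_smul_one_of_star_eq h2]
    simp

/-- The Hermitian matrix `[[S, w], [wᴴ, b]]`. -/
noncomputable def border (S : Matrix (Fin m) (Fin m) 𝔸) (w : Fin m → 𝔸) (b : ℝ) :
    Matrix (Fin (m + 1)) (Fin (m + 1)) 𝔸 :=
  Matrix.of fun i j => Fin.lastCases (Fin.lastCases (b • (1 : 𝔸)) (fun j => star (w j)) j)
    (fun i => Fin.lastCases (w i) (fun j => S i j) j) i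

section Border

variable (S : Matrix (Fin m) (Fin m) 𝔸) (w : Fin m → 𝔸) (b : ℝ)

@[simp] theorem border_castSucc_castSucc (i j : Fin m) :
    border S w b i.castSucc j.castSucc = S i j := by simp [border]

@[simp] theorem border_castSucc_last (i : Fin m) :
    border S w b i.castSucc (Fin.last m) = w i := by simp [border]

@[simp] theorem border_last_castSucc (j : Fin m) :
    border S w b (Fin.last m) j.castSucc = star (w j) := by simp [border]

@[simp] theorem border_last_last : border S w b (Fin.last m) (Fin.last m) = b • (1 : 𝔸) := by
  simp [border]

theorem eq_border {V : Matrix (Fin (m + 1)) (Fin (m + 1)) 𝔸} (hV : Vᴴ = V) :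
    V = border (V.submatrix Fin.castSucc Fin.castSucc) (fun i => V i.castSucc (Fin.last m))
      (𝔸.re (V (Fin.last m) (Fin.last m))) := by
  ext i j
  refine Fin.lastCases ?_ (fun i => ?_) i <;> refine Fin.lastCases ?_ (fun j => ?_) j
  · rw [border_last_last, ← diag_eq_smul_one hV]
  · rw [border_last_castSucc]
    exact (congrFun (congrFun hV (Fin.last m)) j.castSucc).symm
  · simp
  · simp

variable {S w b}

theorem border_isHermitian (hS : Sᴴ = S) : (border S w b)ᴴ = border S w b := by
  ext i j
  have hSji (i j : Fin m) : star (S i j) = S j i := congrFun (congrFun hS j) i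
  rw [Matrix.conjTranspose_apply]
  refine Fin.lastCases ?_ (fun i => ?_) i <;> refine Fin.lastCases ?_ (fun j => ?_) j <;>
    simp [hSji]

theorem isHermitian_of_border (hV : (border S w b)ᴴ = border S w b) : Sᴴ = S := by
  ext i j
  have := congrFun (congrFun hV i.castSucc) j.castSucc
  simpa using this

theorem border_mulVec_castSucc (p : Fin (m + 1) → 𝔸) (i : Fin m) :
    (border S w b *ᵥ p) i.castSucc =
      (S *ᵥ (fun j => p j.castSucc)) i + w i * p (Fin.last m) := by
  simp [Matrix.mulVec, dotProduct, Fin.sum_univ_castSucc]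

theorem border_mulVec_last (p : Fin (m + 1) → 𝔸) :
    (border S w b *ᵥ p) (Fin.last m) =
      star w ⬝ᵥ (fun j => p j.castSucc) + b • p (Fin.last m) := by
  simp [Matrix.mulVec, dotProduct, Fin.sum_univ_castSucc]

/-- Completing the square, with u in the role of S⁻¹w. -/
theorem re_star_dotProduct_border_mulVec (h : 𝔸 = .octonion → m ≤ 1) (hS : Sᴴ = S)
    {u : Fin m → 𝔸} (hu : S *ᵥ u = w) (p : Fin m → 𝔸) (t : 𝔸) :
    𝔸.re (star (Fin.snoc p t : Fin (m + 1) → 𝔸) ⬝ᵥ (border S w b *ᵥ (Fin.snoc p t))) =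
      𝔸.re (star (p + fun i => u i * t) ⬝ᵥ (S *ᵥ (p + fun i => u i * t))) +
        (b - 𝔸.re (star w ⬝ᵥ u)) * 𝔸.re (star t * t) := by
  have e1 : 𝔸.re (star (Fin.snoc p t : Fin (m + 1) → 𝔸) ⬝ᵥ (border S w b *ᵥ (Fin.snoc p t))) =
      𝔸.re (star p ⬝ᵥ (S *ᵥ p)) + 𝔸.re (star p ⬝ᵥ (fun i => w i * t)) +
        𝔸.re (star t * (star w ⬝ᵥ p)) + b * 𝔸.re (star t * t) := by
    rw [re_star_dotProduct, Fin.sum_univ_castSucc, re_star_dotProduct, re_star_dotProduct]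
    simp only [border_mulVec_castSucc, border_mulVec_last, Fin.snoc_castSucc, Fin.snoc_last,
      mul_add, NormedDivAlg.re_add, Finset.sum_add_distrib, mul_smul_comm, NormedDivAlg.re_smul,
      add_assoc]
  have e2 (p : Fin m → 𝔸) :
      𝔸.re (star t * (star w ⬝ᵥ p)) = 𝔸.re (star (fun i => w i * t) ⬝ᵥ p) := by
    rw [re_star_dotProduct, dotProduct, Finset.mul_sum, NormedDivAlg.re_sum]
    refine Finset.sum_congr rfl fun i _ => ?_
    rw [𝔸.re_star_mul_mul, Pi.star_apply, star_star]
  have e3 : S *ᵥ (fun i => u i * t) = fun i => w i * t := by rw [mulVec_mul_right h hS, hu]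
  have e4 : 𝔸.re (star (fun i => u i * t) ⬝ᵥ (S *ᵥ (p : Fin m → 𝔸))) =
      𝔸.re (star (fun i => w i * t) ⬝ᵥ p) := by
    rw [re_star_dotProduct_mulVec, hS, e3]
  have e5 : 𝔸.re (star (fun i => u i * t) ⬝ᵥ (fun i => w i * t)) =
      𝔸.re (star w ⬝ᵥ u) * 𝔸.re (star t * t) := by
    rw [re_star_dotProduct_comm, ← e2, ← hu, star_mulVec_dotProduct_mul_right h hS, mul_smul_comm,
      NormedDivAlg.re_smul]
  rw [e1, Matrix.mulVec_add, star_add, add_dotProduct, dotProduct_add, dotProduct_add, e3]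
  simp only [NormedDivAlg.re_add]
  rw [e2, e4, e5, re_star_dotProduct_comm p]
  ring

theorem isPosDef_of_border (hV : IsPosDef (border S w b)) : IsPosDef S := by
  refine ⟨isHermitian_of_border hV.1, fun p hp => ?_⟩
  have := hV.2 (Fin.snoc p 0) fun h0 => hp (by
    ext i
    simpa using congrFun h0 i.castSucc)
  rw [re_star_dotProduct, Fin.sum_univ_castSucc] at this
  rw [re_star_dotProduct]
  simpa [border_mulVec_castSucc] using this

theorem IsPosDef.exists_mulVec_eq (hS : IsPosDef S) (w : Fin m → 𝔸) : ∃ u, S *ᵥ u = w := by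
  have hinj : Function.Injective (mulVecReal S) := by
    rw [injective_iff_map_eq_zero]
    intro p hp
    by_contra hp0
    have := hS.2 p hp0
    rw [show S *ᵥ p = 0 from hp] at this
    simp at this
  exact LinearMap.injective_iff_surjective.1 hinj w

theorem IsPosDef.re_nonneg (hS : IsPosDef S) (p : Fin m → 𝔸) :
    0 ≤ 𝔸.re (star p ⬝ᵥ (S *ᵥ p)) := by
  by_cases hp : p = 0
  · simp [hp]
  · exact (hS.2 p hp).le

theorem isPosDef_border_iff (h : 𝔸 = .octonion → m ≤ 1) (hS : IsPosDef S)
    {u : Fin m → 𝔸} (hu : S *ᵥ u = w) :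
    IsPosDef (border S w b) ↔ 𝔸.re (star w ⬝ᵥ u) < b := by
  constructor
  · intro hV
    -- The test column (-u, 1) annihilates the completed square and leaves just the Schur
    -- complement.
    have h1 := hV.2 (Fin.snoc (-u) 1) fun h0 => by
      have := congrArg 𝔸.re (congrFun h0 (Fin.last m))
      simp at this
    rw [re_star_dotProduct_border_mulVec h hS.1 hu] at h1
    have h2 : (-u + fun i => u i * 1) = 0 := by
      ext i
      simp
    rw [h2] at h1
    simp at h1
    exact h1
  · refine fun hb => ⟨border_isHermitian hS.1, fun p hp => ?_⟩
    rw [← Fin.snoc_init_self p, re_star_dotProduct_border_mulVec h hS.1 hu]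
    by_cases ht : p (Fin.last m) = 0
    · have hp' : Fin.init p ≠ 0 := fun h0 => hp (by
        rw [← Fin.snoc_init_self p, h0, ht]
        ext i
        refine Fin.lastCases ?_ (fun i => ?_) i <;> simp)
      have h2 : (Fin.init p + fun i => u i * (0 : 𝔸)) = Fin.init p := by
        ext i
        simp
      rw [ht, h2]
      simpa using hS.2 _ hp'
    · exact add_pos_of_nonneg_of_pos (hS.re_nonneg _)
        (mul_pos (sub_pos.2 hb) (𝔸.re_star_mul_self_pos ht))

end Border

/-! ### Determinants of bordered matrices. -/

theorem LinearMap.det_prod_add {F G : Type*} [AddCommGroup F] [Module ℝ F] [Module.Finite ℝ F]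
    [AddCommGroup G] [Module ℝ G] [Module.Finite ℝ G] (A : F →ₗ[ℝ] F) (U : G →ₗ[ℝ] F)
    (R : F →ₗ[ℝ] G) (D : G →ₗ[ℝ] G) :
    LinearMap.det ((A.coprod (A ∘ₗ U)).prod (R.coprod D)) =
      LinearMap.det A * LinearMap.det (D - R ∘ₗ U) := by
  let b := Module.finBasis ℝ F
  let c := Module.finBasis ℝ G
  have h : LinearMap.toMatrix (b.prod c) (b.prod c) ((A.coprod (A ∘ₗ U)).prod (R.coprod D)) =
      Matrix.fromBlocks (LinearMap.toMatrix b b A) 0 (LinearMap.toMatrix b c R)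
        (LinearMap.toMatrix c c (D - R ∘ₗ U)) *
      Matrix.fromBlocks 1 (LinearMap.toMatrix c b U) 0 1 := by
    rw [Matrix.fromBlocks_multiply]
    simp only [Matrix.mul_one, add_zero, Matrix.mul_zero,
      ← LinearMap.toMatrix_comp, map_sub, add_sub_cancel]
    ext (i | i) (j | j) <;> simp [LinearMap.toMatrix_apply]
  rw [← LinearMap.det_toMatrix (b.prod c), h, Matrix.det_mul, Matrix.det_fromBlocks_zero₁₂,
    Matrix.det_fromBlocks_zero₂₁, LinearMap.det_toMatrix, LinearMap.det_toMatrix]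
  simp

/-- Splitting off the last coordinate of a column. -/
noncomputable def initLastEquiv (𝔸 : NormedDivAlg) (m : ℕ) : (Fin (m + 1) → 𝔸) ≃ₗ[ℝ] (Fin m → 𝔸) × 𝔸 where
  toFun p := (fun i => p i.castSucc, p (Fin.last m))
  map_add' _ _ := rfl
  map_smul' _ _ := rfl
  invFun q := Fin.snoc q.1 q.2
  left_inv p := Fin.snoc_init_self p
  right_inv q := by simp

/-- Since w t = S(u t), the upper right block is S ∘ U, so block elimination leaves the Schur
complement. That complement is a real scalar acting on 𝔸 ≅ ℝ^β, whence the power β. -/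
theorem det_mulVecReal_border (h : 𝔸 = .octonion → m ≤ 1) {S : Matrix (Fin m) (Fin m) 𝔸}
    (hS : Sᴴ = S) {w u : Fin m → 𝔸} (hu : S *ᵥ u = w) (b : ℝ) :
    LinearMap.det (mulVecReal (border S w b)) =
      LinearMap.det (mulVecReal S) * (b - 𝔸.re (star w ⬝ᵥ u)) ^ 𝔸.dim := by
  let U : 𝔸 →ₗ[ℝ] (Fin m → 𝔸) :=
    { toFun := fun t i => u i * t
      map_add' := fun s t => by ext i; simp [mul_add]
      map_smul' := fun r t => by ext i; simp [mul_smul_comm] }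
  let R : (Fin m → 𝔸) →ₗ[ℝ] 𝔸 :=
    { toFun := fun p => star w ⬝ᵥ p
      map_add' := fun p q => dotProduct_add _ _ _
      map_smul' := fun r p => dotProduct_smul _ _ _ }
  let D : 𝔸 →ₗ[ℝ] 𝔸 := b • LinearMap.id
  have h1 : (initLastEquiv 𝔸 m).toLinearMap ∘ₗ mulVecReal (border S w b) ∘ₗ
      (initLastEquiv 𝔸 m).symm.toLinearMap =
      ((mulVecReal S).coprod (mulVecReal S ∘ₗ U)).prod (R.coprod D) := by
    refine LinearMap.ext fun q => ?_
    have e3 : S *ᵥ (fun i => u i * q.2) = fun i => w i * q.2 := by rw [mulVec_mul_right h hS, hu]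
    refine Prod.ext ?_ ?_
    · ext i
      refine (border_mulVec_castSucc _ i).trans ?_
      change (S *ᵥ fun j => (Fin.snoc q.1 q.2 : Fin (m + 1) → 𝔸) j.castSucc) i +
        w i * (Fin.snoc q.1 q.2 : Fin (m + 1) → 𝔸) (Fin.last m) =
          (S *ᵥ q.1) i + (S *ᵥ fun i => u i * q.2) i
      simp [e3]
    · refine (border_mulVec_last _).trans ?_
      change (star w ⬝ᵥ fun j => (Fin.snoc q.1 q.2 : Fin (m + 1) → 𝔸) j.castSucc) +
        b • (Fin.snoc q.1 q.2 : Fin (m + 1) → 𝔸) (Fin.last m) = star w ⬝ᵥ q.1 + b • q.2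
      simp
  have h2 : D - R ∘ₗ U = (b - 𝔸.re (star w ⬝ᵥ u)) • LinearMap.id := by
    refine LinearMap.ext fun t => ?_
    have := star_mulVec_dotProduct_mul_right h hS u t
    rw [hu] at this
    simp [D, R, U, this, sub_smul]
  rw [← LinearMap.det_conj _ (initLastEquiv 𝔸 m), h1, LinearMap.det_prod_add, h2,
    LinearMap.det_smul, NormedDivAlg.finrank_eq_dim]
  simp

theorem IsPosDef.det_pos (h : 𝔸 = .octonion → m ≤ 2) {S : Matrix (Fin m) (Fin m) 𝔸}
    (hS : IsPosDef S) : 0 < LinearMap.det (mulVecReal S) := by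
  induction m with
  | zero =>
    rw [show mulVecReal S = LinearMap.id from Subsingleton.elim _ _, LinearMap.det_id]
    exact one_pos
  | succ m ih =>
    have h' : 𝔸 = .octonion → m ≤ 1 := fun h𝔸 => Nat.le_of_succ_le_succ (h h𝔸)
    have hb := eq_border hS.1
    rw [hb] at hS
    have hS' := isPosDef_of_border hS
    obtain ⟨u, hu⟩ := hS'.exists_mulVec_eq (fun i => S i.castSucc (Fin.last m))
    rw [hb, det_mulVecReal_border h' hS'.1 hu]
    exact mul_pos (ih (fun h𝔸 => (h' h𝔸).trans one_le_two) hS')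
      (pow_pos (sub_pos.2 ((isPosDef_border_iff h' hS' hu).1 hS)) _)

theorem IsPosDef.hermDet_pos (h : 𝔸 = .octonion → m ≤ 2) {S : Matrix (Fin m) (Fin m) 𝔸}
    (hS : IsPosDef S) : 0 < hermDet S :=
  Real.rpow_pos_of_pos (hS.det_pos h) _

theorem IsPosDef.det_eq_hermDet_pow (h : 𝔸 = .octonion → m ≤ 2) {S : Matrix (Fin m) (Fin m) 𝔸}
    (hS : IsPosDef S) : LinearMap.det (mulVecReal S) = hermDet S ^ 𝔸.dim := by
  rw [hermDet, one_div, Real.rpow_inv_natCast_pow (hS.det_pos h).le 𝔸.dim_pos.ne']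

theorem hermDet_border (h : 𝔸 = .octonion → m ≤ 1) {S : Matrix (Fin m) (Fin m) 𝔸}
    (hS : IsPosDef S) {w u : Fin m → 𝔸} (hu : S *ᵥ u = w) {b : ℝ}
    (hb : 𝔸.re (star w ⬝ᵥ u) < b) :
    hermDet (border S w b) = hermDet S * (b - 𝔸.re (star w ⬝ᵥ u)) := by
  rw [hermDet, det_mulVecReal_border h hS.1 hu, Real.mul_rpow
    (hS.det_pos fun h𝔸 => (h h𝔸).trans one_le_two).le (pow_nonneg (sub_nonneg.2 hb.le) _),
    one_div, Real.pow_rpow_inv_natCast (sub_nonneg.2 hb.le) 𝔸.dim_pos.ne', hermDet, one_div]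

end Algebra

/-! ### Measurability -/

section Measurability

open scoped ENNReal

variable {𝔸 : NormedDivAlg} {m n : ℕ}

theorem measurable_matrix_iff {α ι κ : Type*} [MeasurableSpace α] {β : Type*} [MeasurableSpace β]
    {f : β → Matrix ι κ α} : Measurable f ↔ ∀ i j, Measurable fun x => f x i j :=
  measurable_pi_iff.trans (forall_congr' fun _ => measurable_pi_iff)

theorem measurable_entry {α ι κ : Type*} [MeasurableSpace α] (i : ι) (j : κ) :
    Measurable fun S : Matrix ι κ α => S i j :=
  measurable_matrix_iff.1 measurable_id i j

theorem measurable_reTrace : Measurable (reTrace (𝔸 := 𝔸) (m := m)) :=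
  𝔸.measurable_re.comp (Finset.measurable_sum _ fun i _ => measurable_entry i i)

theorem measurable_conjTranspose_mul_self {ι : Type*} [Fintype ι] :
    Measurable fun X : Matrix ι (Fin m) 𝔸 => Xᴴ * X :=
  measurable_matrix_iff.2 fun i j => by
    simp only [Matrix.mul_apply, Matrix.conjTranspose_apply]
    exact Finset.measurable_sum _ fun k _ =>
      (𝔸.measurable_star.comp (measurable_entry k i)).mul (measurable_entry k j)

theorem measurable_border :
    Measurable fun p : (Matrix (Fin m) (Fin m) 𝔸 × (Fin m → 𝔸)) × ℝ =>
      border p.1.1 p.1.2 p.2 := by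
  refine measurable_matrix_iff.2 fun i j => ?_
  refine Fin.lastCases ?_ (fun i => ?_) i <;> refine Fin.lastCases ?_ (fun j => ?_) j
  · simp only [border_last_last]
    exact measurable_snd.smul_const _
  · simp only [border_last_castSucc]
    exact 𝔸.measurable_star.comp ((measurable_pi_apply j).comp (measurable_snd.comp measurable_fst))
  · simp only [border_castSucc_last]
    exact (measurable_pi_apply i).comp (measurable_snd.comp measurable_fst)
  · simp only [border_castSucc_castSucc]
    exact (measurable_entry i j).comp (measurable_fst.comp measurable_fst)

theorem measurable_det_mulVecReal :
    Measurable fun S : Matrix (Fin m) (Fin m) 𝔸 => LinearMap.det (mulVecReal S) := by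
  let b := Module.finBasis ℝ (Fin m → 𝔸)
  have hentry (i j) : Measurable fun S : Matrix (Fin m) (Fin m) 𝔸 =>
      LinearMap.toMatrix b b (mulVecReal S) i j := by
    -- Each entry of the real matrix of p ↦ S p is a real-linear functional of S, hence measurable.
    let T : (Fin m → Fin m → 𝔸) →ₗ[ℝ] ℝ :=
      { toFun := fun S => b.repr (mulVecReal (Matrix.of S) (b j)) i
        map_add' := fun S S' => by
          change b.repr (Matrix.of (S + S') *ᵥ b j) i = _
          rw [← Matrix.of_add_of, Matrix.add_mulVec, map_add]
          rfl
        map_smul' := fun r S => by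
          change b.repr (Matrix.of (r • S) *ᵥ b j) i = _
          rw [← Matrix.smul_of, Matrix.smul_mulVec, map_smul]
          rfl }
    have := ((𝔸.coords.pi (Fin m)).pi (Fin m)).measurable_linearMap
      (OrthoCoords.ofInnerProductSpace ℝ (Module.finrank_self ℝ)) T
    have heq : (fun S : Matrix (Fin m) (Fin m) 𝔸 => LinearMap.toMatrix b b (mulVecReal S) i j) =
        fun S => T S := funext fun S => LinearMap.toMatrix_apply _ _ _ _ _
    rw [heq]
    exact this
  simp only [← LinearMap.det_toMatrix b, Matrix.det_apply']
  exact Finset.measurable_sum _ fun σ _ =>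
    (Finset.measurable_prod _ fun i _ => hentry _ _).const_mul _

theorem measurable_hermDet : Measurable (hermDet (𝔸 := 𝔸) (m := m)) :=
  measurable_det_mulVecReal.pow_const _

theorem measurableSet_isHermitian :
    MeasurableSet {S : Matrix (Fin m) (Fin m) 𝔸 | Sᴴ = S} := by
  -- Equality of entries is expressed by a vanishing real squared norm, so measurability of {0} in ℝ
  -- is enough.
  have : {S : Matrix (Fin m) (Fin m) 𝔸 | Sᴴ = S} = ⋂ i, ⋂ j,
      {S | 𝔸.re (star (star (S j i) + (-1 : ℝ) • S i j) * (star (S j i) + (-1 : ℝ) • S i j))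
        = 0} := by
    ext S
    simp only [Set.mem_ofPred_eq, Set.mem_iInter, NormedDivAlg.re_star_mul_self_eq_zero, neg_smul,
      one_smul, ← sub_eq_add_neg, sub_eq_zero]
    exact ⟨fun h i j => congrFun (congrFun h i) j, fun h => Matrix.ext h⟩
  rw [this]
  refine MeasurableSet.iInter fun i => MeasurableSet.iInter fun j => ?_
  have hd : Measurable fun S : Matrix (Fin m) (Fin m) 𝔸 => star (S j i) + (-1 : ℝ) • S i j :=
    (𝔸.measurable_star.comp (measurable_entry j i)).add ((measurable_entry i j).const_smul (-1 : ℝ))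
  exact (𝔸.measurable_re.comp ((𝔸.measurable_star.comp hd).mul hd)) (measurableSet_singleton 0)

/-- The determinant is det S · s^β with s the Schur complement, and an even β hides the sign of s.
The sign is recovered from monotonicity: s > 0 exactly when s^β is positive and grows whenever s is
increased by 1/(k+1). These conditions are visibly measurable in (S, w, b), as no solution of S u =
w has to be chosen. -/
theorem isPosDef_border_iff_det (h : 𝔸 = .octonion → m ≤ 1) {S : Matrix (Fin m) (Fin m) 𝔸}
    {w : Fin m → 𝔸} {b : ℝ} (hS : IsPosDef S) :
    IsPosDef (border S w b) ↔ 0 < LinearMap.det (mulVecReal (border S w b)) ∧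
      ∀ k : ℕ, LinearMap.det (mulVecReal (border S w b)) <
        LinearMap.det (mulVecReal (border S w (b + 1 / ((k : ℝ) + 1)))) := by
  have h2 : 𝔸 = .octonion → m ≤ 2 := fun h𝔸 => (h h𝔸).trans one_le_two
  have hdet := hS.det_pos h2
  obtain ⟨u, hu⟩ := hS.exists_mulVec_eq w
  simp only [isPosDef_border_iff h hS hu, det_mulVecReal_border h hS.1 hu, mul_pos_iff_of_pos_left
    hdet, mul_lt_mul_iff_right₀ hdet]
  set s := b - 𝔸.re (star w ⬝ᵥ u) with hs
  have hsk (k : ℕ) : b + 1 / ((k : ℝ) + 1) - 𝔸.re (star w ⬝ᵥ u) = s + 1 / ((k : ℝ) + 1) := by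
    rw [hs]
    ring
  simp only [hsk]
  rw [← sub_pos, ← hs]
  constructor
  · exact fun h0 => ⟨pow_pos h0 _, fun k =>
      pow_lt_pow_left₀ (lt_add_of_pos_right _ (by positivity)) h0.le 𝔸.dim_pos.ne'⟩
  · rintro ⟨h0, h1⟩
    by_contra hneg
    have hs0 : s ≠ 0 := fun h00 => by
      rw [h00, zero_pow 𝔸.dim_pos.ne'] at h0
      exact lt_irrefl _ h0
    have hlt : s < 0 := lt_of_le_of_ne (not_lt.1 hneg) hs0
    -- If s < 0, an increase by less than -s moves s towards 0, so s^β = |s|^β cannot grow.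
    obtain ⟨k, hk⟩ := exists_nat_one_div_lt (neg_pos.2 hlt)
    have hkpos : 0 < 1 / ((k : ℝ) + 1) := by positivity
    have habs : |s + 1 / ((k : ℝ) + 1)| ≤ |s| := by
      rw [abs_of_neg hlt, abs_le]
      constructor <;> linarith
    have h3 := calc (s + 1 / ((k : ℝ) + 1)) ^ 𝔸.dim
        ≤ |s + 1 / ((k : ℝ) + 1)| ^ 𝔸.dim := (le_abs_self _).trans_eq (abs_pow _ _)
      _ ≤ |s| ^ 𝔸.dim := pow_le_pow_left₀ (abs_nonneg _) habs _
      _ = s ^ 𝔸.dim := by rw [← abs_pow, abs_of_pos h0]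
    exact absurd (h1 k) (not_lt.2 h3)

theorem measurableSet_isPosDef (h : 𝔸 = .octonion → m ≤ 2) :
    MeasurableSet {S : Matrix (Fin m) (Fin m) 𝔸 | IsPosDef S} := by
  induction m with
  | zero =>
    convert! MeasurableSet.univ
    ext S
    simp only [Set.mem_ofPred_eq, Set.mem_univ, iff_true]
    exact ⟨Subsingleton.elim _ _, fun p hp => absurd (Subsingleton.elim _ _) hp⟩
  | succ m ih =>
    have h' : 𝔸 = .octonion → m ≤ 1 := fun h𝔸 => Nat.le_of_succ_le_succ (h h𝔸)
    let sub : Matrix (Fin (m + 1)) (Fin (m + 1)) 𝔸 → Matrix (Fin m) (Fin m) 𝔸 :=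
      fun V => V.submatrix Fin.castSucc Fin.castSucc
    let col : Matrix (Fin (m + 1)) (Fin (m + 1)) 𝔸 → Fin m → 𝔸 :=
      fun V i => V i.castSucc (Fin.last m)
    let corner : Matrix (Fin (m + 1)) (Fin (m + 1)) 𝔸 → ℝ :=
      fun V => 𝔸.re (V (Fin.last m) (Fin.last m))
    have hsub : Measurable sub := measurable_matrix_iff.2 fun i j => measurable_entry _ _
    have hcol : Measurable col := measurable_pi_lambda _ fun i => measurable_entry _ _
    have hcorner : Measurable corner := 𝔸.measurable_re.comp (measurable_entry _ _)
    have heq : {V : Matrix (Fin (m + 1)) (Fin (m + 1)) 𝔸 | IsPosDef V} =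
        {V | Vᴴ = V} ∩ (sub ⁻¹' {S | IsPosDef S} ∩
          ({V | 0 < LinearMap.det (mulVecReal (border (sub V) (col V) (corner V)))} ∩
          ⋂ k : ℕ, {V | LinearMap.det (mulVecReal (border (sub V) (col V) (corner V))) <
            LinearMap.det (mulVecReal (border (sub V) (col V)
              (corner V + 1 / ((k : ℝ) + 1))))})) := by
      ext V
      simp only [Set.mem_ofPred_eq, Set.mem_inter_iff, Set.mem_preimage, Set.mem_iInter]
      constructor
      · intro hV
        have hb : V = border (sub V) (col V) (corner V) := eq_border hV.1
        have hV' := hV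
        rw [hb] at hV'
        have hS := isPosDef_of_border hV'
        exact ⟨hV.1, hS, (isPosDef_border_iff_det h' hS).1 hV'⟩
      · rintro ⟨hV, hS, hdet⟩
        have hb : V = border (sub V) (col V) (corner V) := eq_border hV
        rw [hb]
        exact (isPosDef_border_iff_det h' hS).2 hdet
    have hdm (c : ℝ) : Measurable fun V =>
        LinearMap.det (mulVecReal (border (sub V) (col V) (corner V + c))) :=
      measurable_det_mulVecReal.comp
        (measurable_border.comp ((hsub.prodMk hcol).prodMk (hcorner.add_const c)))
    have hdm0 := hdm 0
    simp only [add_zero] at hdm0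
    rw [heq]
    exact measurableSet_isHermitian.inter ((hsub (ih fun h𝔸 => (h' h𝔸).trans one_le_two)).inter
      ((measurableSet_lt measurable_const hdm0).inter
        (MeasurableSet.iInter fun k => measurableSet_lt hdm0 (hdm _))))

end Measurability

/-! ### Lebesgue measure on Hermitian matrices, one row and column at a time -/

section Coordinates

open scoped ENNReal

variable {𝔸 : NormedDivAlg} {m n : ℕ}

theorem measurePreserving_sumElim_comp {ι κ κ' α : Type*} [Fintype ι] [Fintype κ] [Fintype κ']
    [MeasureSpace α] [SigmaFinite (volume : Measure α)] (e : ι ≃ κ ⊕ κ') :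
    MeasurePreserving (fun (x : (κ → α) × (κ' → α)) (i : ι) => Sum.elim x.1 x.2 (e i))
      volume volume := by
  have hmeas : Measurable fun (x : (κ → α) × (κ' → α)) (i : ι) => Sum.elim x.1 x.2 (e i) := by
    refine measurable_pi_lambda _ fun i => ?_
    rcases e i with j | j
    · exact (measurable_pi_apply j).comp measurable_fst
    · exact (measurable_pi_apply j).comp measurable_snd
  refine ⟨hmeas, (Measure.pi_eq fun s hs => ?_).symm⟩
  rw [Measure.map_apply hmeas (MeasurableSet.univ_pi hs)]
  have : (fun (x : (κ → α) × (κ' → α)) (i : ι) => Sum.elim x.1 x.2 (e i)) ⁻¹' Set.univ.pi s =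
      (Set.univ.pi fun j => s (e.symm (.inl j))) ×ˢ
        (Set.univ.pi fun j => s (e.symm (.inr j))) := by
    ext x
    simp only [Set.mem_preimage, Set.mem_univ_pi, Set.mem_prod]
    constructor
    · exact fun h => ⟨fun j => by simpa using h (e.symm (.inl j)),
        fun j => by simpa using h (e.symm (.inr j))⟩
    · intro h i
      obtain ⟨i, rfl⟩ := e.symm.surjective i
      rcases i with j | j
      · simpa using h.1 j
      · simpa using h.2 j
  rw [this, Measure.volume_eq_prod, Measure.prod_prod, volume_pi_pi, volume_pi_pi,
    ← Equiv.prod_comp e.symm, Fintype.prod_sum_type]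

theorem measurePreserving_snoc {α : Type*} [MeasureSpace α] [SigmaFinite (volume : Measure α)] :
    MeasurePreserving (fun x : (Fin m → α) × α => (Fin.snoc x.1 x.2 : Fin (m + 1) → α))
      volume volume := by
  have hmeas : Measurable fun x : (Fin m → α) × α => (Fin.snoc x.1 x.2 : Fin (m + 1) → α) := by
    refine measurable_pi_lambda _ fun i => ?_
    refine Fin.lastCases ?_ (fun i => ?_) i
    · simpa using measurable_snd
    · simp only [Fin.snoc_castSucc]
      exact (measurable_pi_apply i).comp measurable_fst
  refine ⟨hmeas, (Measure.pi_eq fun s hs => ?_).symm⟩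
  rw [Measure.map_apply hmeas (MeasurableSet.univ_pi hs)]
  have : (fun x : (Fin m → α) × α => (Fin.snoc x.1 x.2 : Fin (m + 1) → α)) ⁻¹' Set.univ.pi s =
      (Set.univ.pi fun j : Fin m => s j.castSucc) ×ˢ s (Fin.last m) := by
    ext x
    simp [Fin.forall_fin_succ', -Set.mem_pi, Set.mem_univ_pi]
  rw [this, Measure.volume_eq_prod, Measure.prod_prod, volume_pi_pi, Fin.prod_univ_castSucc]

/-- Appending a column to a matrix. -/
def appendCol {ι α : Type*} (X : Matrix ι (Fin m) α) (x : ι → α) : Matrix ι (Fin (m + 1)) α :=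
  Matrix.of fun i => Fin.snoc (X i) (x i)

theorem measurePreserving_appendCol {ι α : Type*} [Fintype ι] [MeasureSpace α]
    [SigmaFinite (volume : Measure α)] :
    MeasurePreserving (fun p : Matrix ι (Fin m) α × (ι → α) => appendCol p.1 p.2) volume volume :=
  (volume_preserving_pi fun _ : ι => measurePreserving_snoc (m := m) (α := α)).comp
    (volume_measurePreserving_arrowProdEquivProdArrow (Fin m → α) α ι).symm

theorem conjTranspose_appendCol_mul_self (X : Matrix (Fin n) (Fin m) 𝔸) (x : Fin n → 𝔸) :
    (appendCol X x)ᴴ * appendCol X x = border (Xᴴ * X) (Xᴴ *ᵥ x) (∑ i, 𝔸.re (star (x i) * x i)) := by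
  ext i j
  refine Fin.lastCases ?_ (fun i => ?_) i <;> refine Fin.lastCases ?_ (fun j => ?_) j
  · simp only [Matrix.mul_apply, Matrix.conjTranspose_apply, appendCol, Matrix.of_apply,
      Fin.snoc_last, border_last_last, Finset.sum_smul]
    refine Finset.sum_congr rfl fun i _ => ?_
    have := 𝔸.star_mul_mul_self (x i) 1
    rwa [mul_one] at this
  · simp [Matrix.mul_apply, appendCol, Matrix.mulVec, dotProduct]
  · simp [Matrix.mul_apply, appendCol, Matrix.mulVec, dotProduct]
  · simp [Matrix.mul_apply, appendCol]

/-- The pairs `i < j` in `Fin (m + 1)`: either `j` is not the last index, or it is. -/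
noncomputable def upperIndexEquiv (m : ℕ) :
    {p : Fin (m + 1) × Fin (m + 1) // p.1 < p.2} ≃ {p : Fin m × Fin m // p.1 < p.2} ⊕ Fin m :=
  (Equiv.ofBijective
    (Sum.elim (fun p => ⟨(p.1.1.castSucc, p.1.2.castSucc), Fin.castSucc_lt_castSucc_iff.2 p.2⟩)
      (fun i => ⟨(i.castSucc, Fin.last m), Fin.castSucc_lt_last i⟩))
    (by
      constructor
      · rintro (⟨⟨i, j⟩, hij⟩ | i) (⟨⟨i', j'⟩, hij'⟩ | i') h
        · simpa using h
        · exact absurd (congrArg (fun p => p.1.2) h) (Fin.castSucc_lt_last j).ne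
        · exact absurd (congrArg (fun p => p.1.2) h).symm (Fin.castSucc_lt_last j').ne
        · simpa using h
      · rintro ⟨⟨i, j⟩, hij⟩
        have hi : i ≠ Fin.last m := (lt_of_lt_of_le hij (Fin.le_last j)).ne
        obtain ⟨i, rfl⟩ := Fin.exists_castSucc_eq.2 hi
        induction j using Fin.lastCases with
        | last => exact ⟨.inr i, rfl⟩
        | cast j => exact ⟨.inl ⟨(i, j), Fin.castSucc_lt_castSucc_iff.1 hij⟩, rfl⟩)).symm

theorem upperIndexEquiv_castSucc {i j : Fin m} (h : i.castSucc < j.castSucc) :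
    upperIndexEquiv m ⟨(i.castSucc, j.castSucc), h⟩ =
      .inl ⟨(i, j), Fin.castSucc_lt_castSucc_iff.1 h⟩ := by
  rw [upperIndexEquiv, Equiv.symm_apply_eq]
  rfl

theorem upperIndexEquiv_last {i : Fin m} (h : i.castSucc < Fin.last m) :
    upperIndexEquiv m ⟨(i.castSucc, Fin.last m), h⟩ = .inr i := by
  rw [upperIndexEquiv, Equiv.symm_apply_eq]
  rfl

theorem hermOfCoords_snoc (d : Fin m → ℝ) (c : {p : Fin m × Fin m // p.1 < p.2} → 𝔸)
    (w : Fin m → 𝔸) (b : ℝ) :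
    hermOfCoords 𝔸 (m + 1) (Fin.snoc d b, fun p => Sum.elim c w (upperIndexEquiv m p)) =
      border (hermOfCoords 𝔸 m (d, c)) w b := by
  ext i j
  refine Fin.lastCases ?_ (fun i => ?_) i <;> refine Fin.lastCases ?_ (fun j => ?_) j
  · simp [hermOfCoords]
  · have h1 : ¬ Fin.last m < j.castSucc := (Fin.castSucc_lt_last j).le.not_gt
    simp [hermOfCoords, h1, Fin.castSucc_lt_last, upperIndexEquiv_last]
  · simp [hermOfCoords, Fin.castSucc_lt_last, upperIndexEquiv_last]
  · simp [hermOfCoords, upperIndexEquiv_castSucc]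

theorem measurable_hermOfCoords : Measurable (hermOfCoords 𝔸 m) := by
  refine measurable_matrix_iff.2 fun i j => ?_
  simp only [hermOfCoords, Matrix.of_apply]
  split_ifs with h1 h2
  · exact (measurable_pi_apply _).comp measurable_snd
  · exact 𝔸.measurable_star.comp ((measurable_pi_apply _).comp measurable_snd)
  · exact ((measurable_pi_apply i).comp measurable_fst).smul_const _

theorem measurable_lintegral_border {f : Matrix (Fin (m + 1)) (Fin (m + 1)) 𝔸 → ℝ≥0∞}
    (hf : Measurable f) :
    Measurable fun S : Matrix (Fin m) (Fin m) 𝔸 =>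
      ∫⁻ w : Fin m → 𝔸, ∫⁻ b : ℝ, f (border S w b) := by
  have h1 : Measurable fun p : Matrix (Fin m) (Fin m) 𝔸 × (Fin m → 𝔸) =>
      ∫⁻ b : ℝ, f (border p.1 p.2 b) :=
    Measurable.lintegral_prod_right'
      (f := fun p : (Matrix (Fin m) (Fin m) 𝔸 × (Fin m → 𝔸)) × ℝ => f (border p.1.1 p.1.2 p.2))
      (hf.comp measurable_border)
  exact h1.lintegral_prod_right'

/-- Fubini: the coordinates of the larger matrix are those of its leading block, its last column and
its corner. -/
theorem lintegral_lebesgueHerm_succ {f : Matrix (Fin (m + 1)) (Fin (m + 1)) 𝔸 → ℝ≥0∞}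
    (hf : Measurable f) :
    ∫⁻ V, f V ∂lebesgueHerm 𝔸 (m + 1) =
      ∫⁻ S, (∫⁻ w : Fin m → 𝔸, ∫⁻ b : ℝ, f (border S w b)) ∂lebesgueHerm 𝔸 m := by
  rw [lebesgueHerm, lebesgueHerm, lintegral_map hf measurable_hermOfCoords,
    lintegral_map (measurable_lintegral_border hf) measurable_hermOfCoords]
  have hψ := (measurePreserving_snoc (m := m) (α := ℝ)).prod
      (measurePreserving_sumElim_comp (α := 𝔸) (upperIndexEquiv m))
  let Φ : ((Fin m → ℝ) × ℝ) × (({p : Fin m × Fin m // p.1 < p.2} → 𝔸) × (Fin m → 𝔸)) → ℝ≥0∞ :=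
    fun p => f (border (hermOfCoords 𝔸 m (p.1.1, p.2.1)) p.2.2 p.1.2)
  have hΦ : Measurable Φ := by
    refine hf.comp (measurable_border.comp (((measurable_hermOfCoords.comp ?_).prodMk ?_).prodMk ?_))
    · exact (measurable_fst.comp measurable_fst).prodMk (measurable_fst.comp measurable_snd)
    · exact measurable_snd.comp measurable_snd
    · exact measurable_snd.comp measurable_fst
  have h1 := hψ.lintegral_comp (hf.comp measurable_hermOfCoords)
  refine h1.symm.trans ?_
  have h2 : ∀ p : ((Fin m → ℝ) × ℝ) × (({p : Fin m × Fin m // p.1 < p.2} → 𝔸) × (Fin m → 𝔸)),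
      (f ∘ hermOfCoords 𝔸 (m + 1)) (Prod.map
        (fun x : (Fin m → ℝ) × ℝ => (Fin.snoc x.1 x.2 : Fin (m + 1) → ℝ))
        (fun (x : ({p : Fin m × Fin m // p.1 < p.2} → 𝔸) × (Fin m → 𝔸)) i =>
          Sum.elim x.1 x.2 (upperIndexEquiv m i)) p) = Φ p :=
    fun p => congrArg f (hermOfCoords_snoc _ _ _ _)
  rw [lintegral_congr h2, lintegral_prod _ hΦ.aemeasurable, Measure.volume_eq_prod,
    lintegral_prod _ (Measurable.lintegral_prod_right' hΦ).aemeasurable, Measure.volume_eq_prod]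
  have h3 : Measurable fun p : (Fin m → ℝ) × ({p : Fin m × Fin m // p.1 < p.2} → 𝔸) =>
      ∫⁻ w : Fin m → 𝔸, ∫⁻ b : ℝ, f (border (hermOfCoords 𝔸 m p) w b) :=
    (measurable_lintegral_border hf).comp measurable_hermOfCoords
  refine Eq.trans (lintegral_congr fun d => ?_) (lintegral_prod _ h3.aemeasurable).symm
  have hΦd : Measurable fun p : ℝ × (({p : Fin m × Fin m // p.1 < p.2} → 𝔸) × (Fin m → 𝔸)) =>
      Φ ((d, p.1), p.2) :=
    hΦ.comp ((measurable_const.prodMk measurable_fst).prodMk measurable_snd)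
  -- The corner b comes right after the diagonal d in the coordinates; it is moved to the innermost
  -- place.
  rw [lintegral_lintegral_swap hΦd.aemeasurable,
    lintegral_prod _ (Measurable.lintegral_prod_left' hΦd).aemeasurable]

end Coordinates

/-! ### The image of Lebesgue measure under `X ↦ Xᴴ X` -/

section Wishart

open scoped ENNReal

variable {𝔸 : NormedDivAlg} {m n : ℕ}

theorem lebesgueHerm_zero_univ : lebesgueHerm 𝔸 0 Set.univ = 1 := by
  have : IsEmpty {p : Fin 0 × Fin 0 // p.1 < p.2} := ⟨fun p => p.1.1.elim0⟩
  rw [lebesgueHerm, Measure.map_apply measurable_hermOfCoords MeasurableSet.univ,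
    Set.preimage_univ, Measure.volume_eq_prod, ← Set.univ_prod_univ, Measure.prod_prod,
    volume_pi, volume_pi, Measure.pi_univ, Measure.pi_univ]
  simp

theorem isPosDef_of_isEmpty (V : Matrix (Fin 0) (Fin 0) 𝔸) : IsPosDef V :=
  ⟨Subsingleton.elim _ _, fun _ hp => absurd (Subsingleton.elim _ _) hp⟩

theorem hermDet_of_isEmpty (V : Matrix (Fin 0) (Fin 0) 𝔸) : hermDet V = 1 := by
  rw [hermDet, show mulVecReal V = LinearMap.id from Subsingleton.elim _ _, LinearMap.det_id,
    Real.one_rpow]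

/-- A substitute for S⁻¹; real linearity makes the chosen solution measurable in w. -/
theorem IsPosDef.exists_linear_mulVec_eq {S : Matrix (Fin m) (Fin m) 𝔸} (hS : IsPosDef S) :
    ∃ u : (Fin m → 𝔸) →ₗ[ℝ] (Fin m → 𝔸), ∀ w, S *ᵥ u w = w := by
  obtain ⟨u, hu⟩ := LinearMap.exists_rightInverse_of_surjective (mulVecReal S)
    (LinearMap.range_eq_top.2 hS.exists_mulVec_eq)
  exact ⟨u, fun w => congrArg (fun f : (Fin m → 𝔸) →ₗ[ℝ] (Fin m → 𝔸) => f w) hu⟩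

/-- The conditional step of the induction: `lintegral_linearMap_norm_sq` for T = Xᴴ, whose adjoint
is X and for which T T* is p ↦ S p. The kernel has real dimension β(n - m), positive because m < n.
-/
theorem lintegral_border_conjTranspose_mulVec (h : 𝔸 = .octonion → m ≤ 1) (hmn : m < n)
    (X : Matrix (Fin n) (Fin m) 𝔸) (hX : IsPosDef (Xᴴ * X))
    {g : Matrix (Fin (m + 1)) (Fin (m + 1)) 𝔸 → ℝ≥0∞} (hg : Measurable g) :
    ∫⁻ x : Fin n → 𝔸, g (border (Xᴴ * X) (Xᴴ *ᵥ x) (∑ i, 𝔸.re (star (x i) * x i))) =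
      halfSphereArea (𝔸.dim * (n - m)) *
        ENNReal.ofReal
          (hermDet (Xᴴ * X) ^ (-(𝔸.dim / 2) - (𝔸.dim * ((n : ℝ) - m) / 2 - 1) : ℝ)) *
        ∫⁻ w : Fin m → 𝔸, ∫⁻ b : ℝ, {V | IsPosDef V}.indicator
          (fun V => ENNReal.ofReal (hermDet V ^ ((𝔸.dim * ((n : ℝ) - m) / 2 - 1) : ℝ)) * g V)
          (border (Xᴴ * X) w b) := by
  set S := Xᴴ * X with hS_def
  have h2 : 𝔸 = .octonion → m ≤ 2 := fun h𝔸 => (h h𝔸).trans one_le_two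
  obtain ⟨u, hu⟩ := IsPosDef.exists_linear_mulVec_eq hX
  have hTS : mulVecRealRect Xᴴ ∘ₗ mulVecRealRect X = mulVecReal S :=
    LinearMap.ext fun p => conjTranspose_mulVec_mulVec h X p
  have hd : 0 < 𝔸.dim * (n - m) := Nat.mul_pos 𝔸.dim_pos (Nat.sub_pos_of_lt hmn)
  have hcard : Fintype.card (Σ _ : Fin n, Fin 𝔸.dim) =
      Fintype.card (Σ _ : Fin m, Fin 𝔸.dim) + 𝔸.dim * (n - m) := by
    simp only [Fintype.card_sigma, Fintype.card_fin, Finset.sum_const, Finset.card_univ,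
      smul_eq_mul]
    rw [mul_comm n, mul_comm m, ← Nat.mul_add, Nat.add_sub_cancel' hmn.le]
  have key := (𝔸.coords.pi (Fin n)).lintegral_linearMap_self (𝔸.coords.pi (Fin m)) hcard hd
    (mulVecRealRect Xᴴ) (mulVecRealRect X)
    (fun w v => by
      have := re_star_dotProduct_mulVec Xᴴ w v
      rw [re_star_dotProduct, re_star_dotProduct, Matrix.conjTranspose_conjTranspose] at this
      exact this)
    (u := u) (fun w => by
      have := congrArg (fun f : (Fin m → 𝔸) →ₗ[ℝ] (Fin m → 𝔸) => f (u w)) hTS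
      exact this.trans (hu w))
    ((𝔸.coords.pi (Fin m)).measurable_linearMap (𝔸.coords.pi (Fin m)) u)
    (g := fun p => g (border S p.1 p.2))
    (hg.comp (measurable_border.comp
      ((measurable_const.prodMk measurable_fst).prodMk measurable_snd)))
  refine key.trans ?_
  rw [hTS, mul_assoc, mul_assoc]
  congr 1
  have hpos := hX.hermDet_pos h2
  have hcast : ((𝔸.dim * (n - m) : ℕ) : ℝ) = 𝔸.dim * ((n : ℝ) - m) := by
    rw [Nat.cast_mul, Nat.cast_sub hmn.le]
  set e : ℝ := 𝔸.dim * ((n : ℝ) - m) / 2 - 1 with he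
  -- det^(-1/2) = |S|^(-β/2); the factor |S|^e is split off to combine with (b - wᴴu)^e into |V|^e.
  have hdet : LinearMap.det (mulVecReal S) ^ (-(1 / 2) : ℝ) =
      hermDet S ^ (-(𝔸.dim / 2) - e : ℝ) * hermDet S ^ e := by
    rw [hX.det_eq_hermDet_pow h2, ← Real.rpow_natCast, ← Real.rpow_mul hpos.le,
      ← Real.rpow_add hpos]
    congr 1
    ring
  rw [hdet, ENNReal.ofReal_mul (Real.rpow_nonneg hpos.le _), mul_assoc,
    ← lintegral_const_mul' _ _ ENNReal.ofReal_ne_top]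
  congr 1
  refine lintegral_congr fun w => ?_
  have hq : ∑ i, 𝔸.re (star (w i) * u w i) = 𝔸.re (star w ⬝ᵥ u w) :=
    (re_star_dotProduct _ _).symm
  rw [← lintegral_const_mul' _ _ ENNReal.ofReal_ne_top, hq,
    ← lintegral_indicator measurableSet_Ioi]
  refine lintegral_congr fun b => ?_
  by_cases hb : 𝔸.re (star w ⬝ᵥ u w) < b
  · rw [Set.indicator_of_mem (show b ∈ Set.Ioi _ from hb),
      Set.indicator_of_mem (show border S w b ∈ {V | IsPosDef V} from
        (isPosDef_border_iff h hX (hu w)).2 hb), hermDet_border h hX (hu w) hb,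
      Real.mul_rpow hpos.le (sub_pos.2 hb).le, ENNReal.ofReal_mul (Real.rpow_nonneg hpos.le _),
      hcast, mul_assoc]
  · rw [Set.indicator_of_notMem (show b ∉ Set.Ioi _ from hb),
      Set.indicator_of_notMem (show border S w b ∉ {V | IsPosDef V} from
        fun hV => hb ((isPosDef_border_iff h hX (hu w)).1 hV))]

theorem exists_lintegral_conjTranspose_mul_self (h : 𝔸 = .octonion → m ≤ 2) (hmn : m ≤ n) :
    ∃ C : ℝ≥0∞, ∀ g : Matrix (Fin m) (Fin m) 𝔸 → ℝ≥0∞, Measurable g →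
      ∫⁻ X : Matrix (Fin n) (Fin m) 𝔸, g (Xᴴ * X) =
        C * ∫⁻ V, {V | IsPosDef V}.indicator (fun V => ENNReal.ofReal
          (hermDet V ^ ((𝔸.dim : ℝ) * ((n : ℝ) - m + 1) / 2 - 1)) * g V) V ∂lebesgueHerm 𝔸 m := by
  induction m with
  | zero =>
    refine ⟨(volume : Measure (Matrix (Fin n) (Fin 0) 𝔸)) Set.univ, fun g hg => ?_⟩
    have hind (V : Matrix (Fin 0) (Fin 0) 𝔸) : {V | IsPosDef V}.indicator (fun V => ENNReal.ofReal
        (hermDet V ^ ((𝔸.dim : ℝ) * ((n : ℝ) - (0 : ℕ) + 1) / 2 - 1)) * g V) V = g 0 := by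
      rw [Set.indicator_of_mem (show V ∈ {V | IsPosDef V} from isPosDef_of_isEmpty V),
        hermDet_of_isEmpty, Real.one_rpow, ENNReal.ofReal_one, one_mul, Subsingleton.elim V 0]
    have hg0 (X : Matrix (Fin n) (Fin 0) 𝔸) : g (Xᴴ * X) = g 0 := by
      rw [Subsingleton.elim (Xᴴ * X) 0]
    simp only [hind, hg0, lintegral_const, lebesgueHerm_zero_univ, mul_one]
    rw [mul_comm]
  | succ m ih =>
    have h' : 𝔸 = .octonion → m ≤ 1 := fun h𝔸 => Nat.le_of_succ_le_succ (h h𝔸)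
    have h2 : 𝔸 = .octonion → m ≤ 2 := fun h𝔸 => (h' h𝔸).trans one_le_two
    obtain ⟨C, hC⟩ := ih h2 (Nat.le_of_succ_le hmn)
    have hPD := measurableSet_isPosDef h2
    -- Almost sure positive definiteness is the induction hypothesis applied to the indicator of the
    -- complement.
    have hae : ∀ᵐ X : Matrix (Fin n) (Fin m) 𝔸, IsPosDef (Xᴴ * X) := by
      have h0 := hC ({V | IsPosDef V}ᶜ.indicator 1) (measurable_one.indicator hPD.compl)
      have h1 : ∀ V : Matrix (Fin m) (Fin m) 𝔸, {V | IsPosDef V}.indicator (fun V => ENNReal.ofReal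
          (hermDet V ^ ((𝔸.dim : ℝ) * ((n : ℝ) - m + 1) / 2 - 1)) *
            {V | IsPosDef V}ᶜ.indicator 1 V) V = 0 := by
        intro V
        by_cases hV : V ∈ {V | IsPosDef V} <;> simp [hV]
      rw [lintegral_congr h1, lintegral_zero, mul_zero] at h0
      have hm0 : Measurable fun X : Matrix (Fin n) (Fin m) 𝔸 =>
          {V : Matrix (Fin m) (Fin m) 𝔸 | IsPosDef V}ᶜ.indicator (1 : Matrix (Fin m) (Fin m) 𝔸 → ℝ≥0∞) (Xᴴ * X) :=
        (measurable_one.indicator hPD.compl).comp measurable_conjTranspose_mul_self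
      filter_upwards [(lintegral_eq_zero_iff hm0).1 h0] with X hX
      by_contra hcon
      have : Xᴴ * X ∈ {V | IsPosDef V}ᶜ := hcon
      simp [Set.indicator_of_mem this] at hX
    refine ⟨C * halfSphereArea (𝔸.dim * (n - m)), fun g hg => ?_⟩
    set e : ℝ := 𝔸.dim * ((n : ℝ) - m) / 2 - 1 with he
    have hee : (𝔸.dim : ℝ) * ((n : ℝ) - (m + 1 : ℕ) + 1) / 2 - 1 = e := by
      rw [he]
      push_cast
      ring
    rw [hee]
    set F : Matrix (Fin (m + 1)) (Fin (m + 1)) 𝔸 → ℝ≥0∞ := {V | IsPosDef V}.indicator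
      (fun V => ENNReal.ofReal (hermDet V ^ e) * g V) with hF
    have hFm : Measurable F :=
      ((measurable_hermDet.pow_const e).ennreal_ofReal.mul hg).indicator (measurableSet_isPosDef h)
    set G : Matrix (Fin m) (Fin m) 𝔸 → ℝ≥0∞ := fun S =>
      ∫⁻ w : Fin m → 𝔸, ∫⁻ b : ℝ, F (border S w b) with hG
    have hGm : Measurable G := measurable_lintegral_border hFm
    have hgm : Measurable fun S : Matrix (Fin m) (Fin m) 𝔸 =>
        halfSphereArea (𝔸.dim * (n - m)) *
          ENNReal.ofReal (hermDet S ^ (-(𝔸.dim / 2) - e : ℝ)) * G S :=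
      ((measurable_hermDet.pow_const _).ennreal_ofReal.const_mul _).mul hGm
    calc ∫⁻ X : Matrix (Fin n) (Fin (m + 1)) 𝔸, g (Xᴴ * X)
        = ∫⁻ X : Matrix (Fin n) (Fin m) 𝔸, ∫⁻ x : Fin n → 𝔸,
            g (border (Xᴴ * X) (Xᴴ *ᵥ x) (∑ i, 𝔸.re (star (x i) * x i))) := by
          have hmp := measurePreserving_appendCol (m := m) (ι := Fin n) (α := 𝔸)
          have hgx := hg.comp (measurable_conjTranspose_mul_self (𝔸 := 𝔸) (m := m + 1)
            (ι := Fin n))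
          refine (hmp.lintegral_comp hgx).symm.trans ?_
          refine (lintegral_prod _ (hgx.comp hmp.measurable).aemeasurable).trans ?_
          simp only [Function.comp_def, conjTranspose_appendCol_mul_self]
      _ = ∫⁻ X : Matrix (Fin n) (Fin m) 𝔸, (fun S => halfSphereArea (𝔸.dim * (n - m)) *
            ENNReal.ofReal (hermDet S ^ (-(𝔸.dim / 2) - e : ℝ)) * G S) (Xᴴ * X) := by
          refine lintegral_congr_ae ?_
          filter_upwards [hae] with X hX
          exact lintegral_border_conjTranspose_mulVec h' hmn X hX hg
      _ = C * ∫⁻ S, halfSphereArea (𝔸.dim * (n - m)) * G S ∂lebesgueHerm 𝔸 m := by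
          rw [hC _ hgm]
          congr 1
          refine lintegral_congr fun S => ?_
          by_cases hS : IsPosDef S
          · have hpos := hS.hermDet_pos h2
            rw [Set.indicator_of_mem (show S ∈ {V | IsPosDef V} from hS), mul_comm
              (halfSphereArea _) (ENNReal.ofReal _), ← mul_assoc, ← mul_assoc,
              ← ENNReal.ofReal_mul (Real.rpow_nonneg hpos.le _), ← Real.rpow_add hpos]
            -- The induction hypothesis weights S by |S|^(e + β/2), exactly inverse to the power
            -- left by the new column.
            have : (𝔸.dim : ℝ) * ((n : ℝ) - m + 1) / 2 - 1 + (-(𝔸.dim / 2) - e) = 0 := by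
              rw [he]
              ring
            rw [this, Real.rpow_zero, ENNReal.ofReal_one, one_mul]
          · have hF0 (w b) : F (border S w b) = 0 :=
              Set.indicator_of_notMem (show border S w b ∉ {V | IsPosDef V} from
                fun hV => hS (isPosDef_of_border hV)) _
            rw [Set.indicator_of_notMem (show S ∉ {V | IsPosDef V} from hS)]
            simp [hG, hF0]
      _ = C * halfSphereArea (𝔸.dim * (n - m)) * ∫⁻ V, F V ∂lebesgueHerm 𝔸 (m + 1) := by
          rw [lintegral_const_mul _ hGm, ← mul_assoc, lintegral_lebesgueHerm_succ hFm]

end Wishart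

/-! ### Normalising constants -/

section Constants

open scoped ENNReal

variable {𝔸 : NormedDivAlg} {m n : ℕ}

theorem OrthoCoords.lintegral_exp_neg_self {V ι : Type*} [AddCommGroup V] [Module ℝ V]
    [MeasureSpace V] [Fintype ι] {B : V → V → ℝ} (e : OrthoCoords V ι B) :
    ∫⁻ x, ENNReal.ofReal (Real.exp (-B x x)) =
      ENNReal.ofReal (Real.pi ^ ((Fintype.card ι : ℝ) / 2)) := by
  have h1 := GaussianFourier.integral_rexp_neg_mul_sq_norm (V := EuclideanSpace ℝ ι) one_pos
  simp only [div_one, finrank_euclideanSpace] at h1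
  -- A non-integrable function would have integral 0 by convention, whereas the value is positive.
  have hint : Integrable fun v : EuclideanSpace ℝ ι => Real.exp (-1 * ‖v‖ ^ 2) := by
    by_contra hcon
    rw [integral_undef hcon] at h1
    exact (Real.rpow_pos_of_pos Real.pi_pos _).ne h1
  rw [← h1, ofReal_integral_eq_lintegral_ofReal hint
    (Filter.Eventually.of_forall fun v => (Real.exp_pos _).le),
    ← e.measurePreserving.lintegral_comp (by fun_prop)]
  simp [e.self_eq_norm_sq]

theorem lintegral_rpow_mul_exp_neg {a : ℝ} (ha : 0 < a) :
    ∫⁻ t in Set.Ioi (0 : ℝ), ENNReal.ofReal (t ^ (a - 1)) * ENNReal.ofReal (Real.exp (-t)) =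
      ENNReal.ofReal (Real.Gamma a) := by
  rw [Real.Gamma_eq_integral ha, ofReal_integral_eq_lintegral_ofReal
    (Real.GammaIntegral_convergent ha)]
  · refine setLIntegral_congr_fun measurableSet_Ioi fun t ht => ?_
    rw [mul_comm, ENNReal.ofReal_mul (Real.exp_pos _).le]
  · filter_upwards [ae_restrict_mem measurableSet_Ioi] with t ht
    exact mul_nonneg (Real.exp_pos _).le (Real.rpow_nonneg (le_of_lt ht) _)

/-- The Gaussian integral computed in two ways: as a power of π and in polar coordinates. -/
theorem halfSphereArea_eq {d : ℕ} (hd : 0 < d) :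
    halfSphereArea d = ENNReal.ofReal (Real.pi ^ ((d : ℝ) / 2) / Real.Gamma (d / 2)) := by
  have hd2 : (0 : ℝ) < d / 2 := by positivity
  have h1 := (OrthoCoords.ofInnerProductSpace (EuclideanSpace ℝ (Fin d))
    finrank_euclideanSpace_fin).lintegral_exp_neg_self
  simp only [real_inner_self_eq_norm_sq, Fintype.card_fin] at h1
  rw [lintegral_norm_sq_euclideanSpace hd (f := fun t => ENNReal.ofReal (Real.exp (-t)))
    (by fun_prop), lintegral_rpow_mul_exp_neg hd2] at h1
  have hG := Real.Gamma_pos_of_pos hd2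
  rw [ENNReal.ofReal_div_of_pos hG, ← h1, ENNReal.mul_div_cancel_right
    (ENNReal.ofReal_pos.2 hG).ne' ENNReal.ofReal_ne_top]

/-- Orthonormal coordinates on matrices. -/
noncomputable def matrixCoords (𝔸 : NormedDivAlg) (n m : ℕ) :=
  (𝔸.coords.pi (Fin m)).pi (Fin n)

theorem card_matrixCoords (𝔸 : NormedDivAlg) (n m : ℕ) :
    Fintype.card (Σ _ : Fin n, Σ _ : Fin m, Fin 𝔸.dim) = n * m * 𝔸.dim := by
  simp [mul_assoc]

theorem reTrace_conjTranspose_mul_self {ι : Type*} [Fintype ι] (X : Matrix ι (Fin m) 𝔸) :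
    reTrace (Xᴴ * X) = ∑ i, ∑ j, 𝔸.re (star (X i j) * X i j) := by
  simp only [reTrace, Matrix.trace, Matrix.diag, Matrix.mul_apply, Matrix.conjTranspose_apply,
    NormedDivAlg.re_sum]
  exact Finset.sum_comm

theorem lintegral_exp_neg_reTrace (𝔸 : NormedDivAlg) (n m : ℕ) :
    ∫⁻ X : Matrix (Fin n) (Fin m) 𝔸, ENNReal.ofReal (Real.exp (-reTrace (Xᴴ * X))) =
      ENNReal.ofReal (Real.pi ^ (((n * m * 𝔸.dim : ℕ) : ℝ) / 2)) := by
  have := (matrixCoords 𝔸 n m).lintegral_exp_neg_self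
  rw [card_matrixCoords] at this
  rw [← this]
  simp only [reTrace_conjTranspose_mul_self]
  rfl

/-- No convergence is needed: both sides are 0 by convention when the integral diverges. -/
theorem multiGamma_eq_toReal (h : 𝔸 = .octonion → m ≤ 2) (a : ℝ) :
    multiGamma 𝔸 m a = (∫⁻ V, {V | IsPosDef V}.indicator (fun V => ENNReal.ofReal
      (hermDet V ^ (a - ((m : ℝ) - 1) * 𝔸.dim / 2 - 1)) * ENNReal.ofReal (Real.exp (-reTrace V))) V
      ∂lebesgueHerm 𝔸 m).toReal := by
  have hPD := measurableSet_isPosDef (𝔸 := 𝔸) h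
  rw [multiGamma, lintegral_indicator hPD, integral_eq_lintegral_of_nonneg_ae]
  · congr 1
    refine setLIntegral_congr_fun hPD fun V hV => ?_
    rw [mul_comm, ENNReal.ofReal_mul (Real.rpow_nonneg (IsPosDef.hermDet_pos h hV).le _)]
  · filter_upwards [ae_restrict_mem hPD] with V hV
    exact mul_nonneg (Real.exp_pos _).le (Real.rpow_nonneg (IsPosDef.hermDet_pos h hV).le _)
  · exact ((measurable_reTrace.neg.exp).mul (measurable_hermDet.pow_const _)).aestronglyMeasurable

theorem multiGamma_one {a : ℝ} (ha : 0 < a) : multiGamma 𝔸 1 a = Real.Gamma a := by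
  rw [multiGamma_eq_toReal fun _ => one_le_two]
  set F : Matrix (Fin 1) (Fin 1) 𝔸 → ℝ≥0∞ := {V | IsPosDef V}.indicator fun V => ENNReal.ofReal
      (hermDet V ^ (a - (((1 : ℕ) : ℝ) - 1) * 𝔸.dim / 2 - 1)) *
        ENNReal.ofReal (Real.exp (-reTrace V)) with hF
  have hFm : Measurable F :=
    ((measurable_hermDet.pow_const _).ennreal_ofReal.mul
      measurable_reTrace.neg.exp.ennreal_ofReal).indicator
        (measurableSet_isPosDef fun _ => one_le_two)
  -- A 1 × 1 Hermitian matrix is the empty matrix bordered by the real corner b, which reduces the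
  -- integral to Euler's.
  have hb (S : Matrix (Fin 0) (Fin 0) 𝔸) (w : Fin 0 → 𝔸) (b : ℝ) : F (border S w b) =
      (Set.Ioi (0 : ℝ)).indicator
        (fun b => ENNReal.ofReal (b ^ (a - 1)) * ENNReal.ofReal (Real.exp (-b))) b := by
    have hS := isPosDef_of_isEmpty S
    have hu : S *ᵥ (0 : Fin 0 → 𝔸) = w := Subsingleton.elim _ _
    have hiff := isPosDef_border_iff (b := b) (fun _ => zero_le_one) hS hu
    simp only [dotProduct_zero, NormedDivAlg.re_zero] at hiff
    by_cases hb : 0 < b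
    · have hdet := hermDet_border (b := b) (fun _ => zero_le_one) hS hu (by simpa using hb)
      have htr : reTrace (border S w b) = b := by
        rw [reTrace, Matrix.trace, Fin.sum_univ_castSucc]
        simp [-Fin.isValue, -Nat.reduceAdd, Matrix.diag]
        exact (congrArg 𝔸.re (border_last_last S w b)).trans (by simp)
      rw [hF, Set.indicator_of_mem (show border S w b ∈ {V | IsPosDef V} from hiff.2 hb),
        Set.indicator_of_mem (show b ∈ Set.Ioi 0 from hb), hdet, htr, hermDet_of_isEmpty]
      simp
    · rw [hF, Set.indicator_of_notMem (show border S w b ∉ {V | IsPosDef V} from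
          fun hV => hb (hiff.1 hV)), Set.indicator_of_notMem (show b ∉ Set.Ioi 0 from hb)]
  refine (congrArg ENNReal.toReal (lintegral_lebesgueHerm_succ (m := 0) hFm)).trans ?_
  simp only [hb, lintegral_indicator measurableSet_Ioi, lintegral_rpow_mul_exp_neg ha,
    lintegral_const, lebesgueHerm_zero_univ, mul_one, volume_pi, Measure.pi_univ]
  simp [(Real.Gamma_pos_of_pos ha).le]

theorem map_conjTranspose_mul_self (h : 𝔸 = .octonion → m ≤ 2) (hmn : m ≤ n) :
    (volume : Measure (Matrix (Fin n) (Fin m) 𝔸)).map (fun X => Xᴴ * X) =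
      ((lebesgueHerm 𝔸 m).restrict {V | IsPosDef V}).withDensity fun V =>
        ENNReal.ofReal (Real.pi ^ ((𝔸.dim : ℝ) * n * m / 2) *
          (hermDet V ^ ((𝔸.dim : ℝ) * ((n : ℝ) - m + 1) / 2 - 1) /
            multiGamma 𝔸 m ((𝔸.dim : ℝ) * n / 2))) := by
  obtain ⟨C, hC⟩ := exists_lintegral_conjTranspose_mul_self h hmn
  have hPD := measurableSet_isPosDef (𝔸 := 𝔸) h
  set e : ℝ := (𝔸.dim : ℝ) * ((n : ℝ) - m + 1) / 2 - 1 with he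
  set Γ := multiGamma 𝔸 m ((𝔸.dim : ℝ) * n / 2) with hΓ
  have hexp := hC (fun V => ENNReal.ofReal (Real.exp (-reTrace V)))
    measurable_reTrace.neg.exp.ennreal_ofReal
  rw [lintegral_exp_neg_reTrace] at hexp
  have hpi : ((n * m * 𝔸.dim : ℕ) : ℝ) / 2 = (𝔸.dim : ℝ) * n * m / 2 := by
    push_cast
    ring
  rw [hpi] at hexp
  set c := Real.pi ^ ((𝔸.dim : ℝ) * n * m / 2) with hc
  have hcpos : 0 < c := Real.rpow_pos_of_pos Real.pi_pos _
  set I := ∫⁻ V, {V | IsPosDef V}.indicator (fun V => ENNReal.ofReal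
      (hermDet V ^ e) * ENNReal.ofReal (Real.exp (-reTrace V))) V ∂lebesgueHerm 𝔸 m with hI
  have hΓI : Γ = I.toReal := by
    rw [hΓ, multiGamma_eq_toReal h, hI]
    have : (𝔸.dim : ℝ) * n / 2 - ((m : ℝ) - 1) * 𝔸.dim / 2 - 1 = e := by
      rw [he]
      ring
    rw [this]
  have hCI0 : C * I ≠ 0 := by
    rw [← hexp]
    exact (ENNReal.ofReal_pos.2 hcpos).ne'
  have hCItop : C * I ≠ ∞ := by
    rw [← hexp]
    exact ENNReal.ofReal_ne_top
  have hI0 : I ≠ 0 := right_ne_zero_of_mul hCI0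
  have hC0 : C ≠ 0 := left_ne_zero_of_mul hCI0
  -- Convergence and positivity of the Gamma integral are by-products: C · I is a positive finite
  -- power of π.
  have hItop : I ≠ ∞ := fun hI' => hCItop (by rw [hI', ENNReal.mul_top hC0])
  have hΓpos : 0 < Γ := hΓI ▸ ENNReal.toReal_pos hI0 hItop
  have hCeq : C = ENNReal.ofReal (c / Γ) := by
    rw [ENNReal.ofReal_div_of_pos hΓpos, hexp, hΓI, ENNReal.ofReal_toReal hItop,
      ENNReal.mul_div_cancel_right hI0 hItop]
  have hdm : Measurable fun V : Matrix (Fin m) (Fin m) 𝔸 =>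
      ENNReal.ofReal (c * (hermDet V ^ e / Γ)) :=
    (((measurable_hermDet.pow_const e).div_const Γ).const_mul c).ennreal_ofReal
  refine Measure.ext_of_lintegral _ fun g hg => ?_
  rw [lintegral_map hg measurable_conjTranspose_mul_self, hC g hg,
    lintegral_withDensity_eq_lintegral_mul _ hdm hg, lintegral_indicator hPD, hCeq,
    ← lintegral_const_mul' _ _ ENNReal.ofReal_ne_top]
  refine lintegral_congr fun V => ?_
  rw [← mul_assoc, ← ENNReal.ofReal_mul (div_pos hcpos hΓpos).le, Pi.mul_apply]
  congr 2
  ring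

theorem map_reTrace_conjTranspose_mul_self (hm : 0 < m) (hn : 0 < n) :
    (volume : Measure (Matrix (Fin n) (Fin m) 𝔸)).map (fun X => reTrace (Xᴴ * X)) =
      ((volume : Measure ℝ).restrict (Set.Ioi 0)).withDensity fun v =>
        ENNReal.ofReal (Real.pi ^ ((n : ℝ) * m * 𝔸.dim / 2) *
          (v ^ ((n : ℝ) * m * 𝔸.dim / 2 - 1) / multiGamma 𝔸 1 ((n : ℝ) * m * 𝔸.dim / 2))) := by
  have hd : 0 < n * m * 𝔸.dim := Nat.mul_pos (Nat.mul_pos hn hm) 𝔸.dim_pos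
  have hd2 : (0 : ℝ) < ((n * m * 𝔸.dim : ℕ) : ℝ) / 2 := by positivity
  have hcast : (n : ℝ) * m * 𝔸.dim / 2 = ((n * m * 𝔸.dim : ℕ) : ℝ) / 2 := by push_cast; rfl
  rw [hcast, multiGamma_one hd2]
  set d := n * m * 𝔸.dim with hd_def
  refine Measure.ext_of_lintegral _ fun g hg => ?_
  have hdm : Measurable fun v : ℝ => ENNReal.ofReal (Real.pi ^ ((d : ℝ) / 2) *
      (v ^ ((d : ℝ) / 2 - 1) / Real.Gamma ((d : ℝ) / 2))) := by fun_prop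
  have hE : Module.finrank ℝ (EuclideanSpace ℝ (Σ _ : Fin n, Σ _ : Fin m, Fin 𝔸.dim)) = d := by
    rw [finrank_euclideanSpace, card_matrixCoords]
  have h1 : ∫⁻ X : Matrix (Fin n) (Fin m) 𝔸, g (reTrace (Xᴴ * X)) =
      ∫⁻ z : EuclideanSpace ℝ (Σ _ : Fin n, Σ _ : Fin m, Fin 𝔸.dim), g (‖z‖ ^ 2) := by
    rw [← (matrixCoords 𝔸 n m).measurePreserving.lintegral_comp (by fun_prop)]
    refine lintegral_congr fun X => ?_
    exact congrArg g ((reTrace_conjTranspose_mul_self X).trans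
      ((matrixCoords 𝔸 n m).self_eq_norm_sq X))
  have hmeas : Measurable fun X : Matrix (Fin n) (Fin m) 𝔸 => reTrace (Xᴴ * X) :=
    measurable_reTrace.comp measurable_conjTranspose_mul_self
  rw [lintegral_map hg hmeas, h1,
    lintegral_norm_sq hE hd hg, halfSphereArea_eq hd,
    lintegral_withDensity_eq_lintegral_mul _ hdm hg,
    ← lintegral_const_mul' _ _ ENNReal.ofReal_ne_top]
  refine lintegral_congr fun v => ?_
  rw [← mul_assoc, ← ENNReal.ofReal_mul (by positivity), Pi.mul_apply]
  congr 2
  ring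

end Constants

/-! ### Independent blocks -/

section Blocks

open scoped ENNReal

theorem lintegral_fin_prod {α : Type*} [MeasurableSpace α] (μ : Measure α) [SigmaFinite μ] {k : ℕ}
    {f : Fin k → α → ℝ≥0∞} (hf : ∀ i, Measurable (f i)) :
    ∫⁻ x : Fin k → α, ∏ i, f i (x i) ∂(Measure.pi fun _ => μ) = ∏ i, ∫⁻ a, f i a ∂μ := by
  induction k with
  | zero => simp
  | succ k ih =>
    have hmp := (measurePreserving_piFinSuccAbove (fun _ : Fin (k + 1) => μ) 0).symm
    have hm : Measurable fun x : Fin (k + 1) → α => ∏ i, f i (x i) :=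
      Finset.measurable_prod _ fun i _ => (hf i).comp (measurable_pi_apply i)
    refine (hmp.lintegral_comp hm).symm.trans ?_
    refine (lintegral_prod _ (hm.comp hmp.measurable).aemeasurable).trans ?_
    rw [Fin.prod_univ_succ, ← ih fun i => hf i.succ, ← lintegral_mul_const _ (hf 0)]
    refine lintegral_congr fun a => ?_
    rw [← lintegral_const_mul]
    · refine lintegral_congr fun x => ?_
      rw [Function.comp_apply, Fin.prod_univ_succ]
      simp [MeasurableEquiv.piFinSuccAbove, Fin.insertNthEquiv]
    · exact Finset.measurable_prod _ fun i _ => (hf i.succ).comp (measurable_pi_apply i)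

theorem pi_withDensity_fin {α : Type*} [MeasurableSpace α] (μ : Measure α) [SigmaFinite μ] {k : ℕ}
    {f : Fin k → α → ℝ≥0∞} (hf : ∀ i, Measurable (f i))
    [∀ i, SigmaFinite (μ.withDensity (f i))] :
    Measure.pi (fun i => μ.withDensity (f i)) =
      (Measure.pi fun _ => μ).withDensity fun x => ∏ i, f i (x i) := by
  refine (Measure.pi_eq fun s hs => ?_)
  rw [withDensity_apply _ (MeasurableSet.univ_pi hs), ← lintegral_indicator
    (MeasurableSet.univ_pi hs)]
  have : ∀ x : Fin k → α, (Set.univ.pi s).indicator (fun x => ∏ i, f i (x i)) x =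
      ∏ i, (s i).indicator (f i) (x i) := by
    intro x
    by_cases hx : x ∈ Set.univ.pi s
    · rw [Set.indicator_of_mem hx]
      exact Finset.prod_congr rfl fun i _ => (Set.indicator_of_mem (hx i trivial) _).symm
    · rw [Set.indicator_of_notMem hx]
      simp only [Set.mem_univ_pi, not_forall] at hx
      obtain ⟨i, hi⟩ := hx
      exact (Finset.prod_eq_zero (Finset.mem_univ i) (Set.indicator_of_notMem hi _)).symm
  rw [lintegral_congr this, lintegral_fin_prod μ fun i => (hf i).indicator (hs i)]
  exact Finset.prod_congr rfl fun i _ => by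
    rw [withDensity_apply _ (hs i), lintegral_indicator (hs i)]

variable {𝔸 : NormedDivAlg} {k m : ℕ} {n : Fin (k + 1) → ℕ}

theorem reTrace_sum {ι : Type*} (s : Finset ι) (f : ι → Matrix (Fin m) (Fin m) 𝔸) :
    reTrace (∑ i ∈ s, f i) = ∑ i ∈ s, reTrace (f i) := by
  simp only [reTrace, Matrix.trace_sum, NormedDivAlg.re_sum]

theorem sum_reTrace_rowBlock (X : Matrix (Σ i, Fin (n i)) (Fin m) 𝔸) :
    ∑ i, reTrace ((rowBlock i X)ᴴ * rowBlock i X) = reTrace (Xᴴ * X) := by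
  simp only [reTrace_conjTranspose_mul_self, Fintype.sum_sigma]
  rfl

theorem map_rowBlock_volume {α : Type*} [MeasurableSpace α] (μ : Measure α) [SigmaFinite μ]
    {s : Set α} (f : (i : Fin (k + 1)) → Matrix (Fin (n i)) (Fin m) 𝔸 → α)
    (hf : ∀ i, Measurable (f i)) {d : Fin (k + 1) → α → ℝ} (hd : ∀ i, Measurable (d i))
    (hmap : ∀ i, (volume : Measure (Matrix (Fin (n i)) (Fin m) 𝔸)).map (f i) =
      (μ.restrict s).withDensity fun v => ENNReal.ofReal (d i v)) :
    (volume : Measure (Matrix (Σ i, Fin (n i)) (Fin m) 𝔸)).map (fun X i => f i (rowBlock i X)) =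
      ((Measure.pi fun _ => μ).restrict {v | ∀ i, v i ∈ s}).withDensity
        fun v => ∏ i, ENNReal.ofReal (d i (v i)) := by
  have hsplit := (measurePreserving_piCurry_symm
    (fun (i : Fin (k + 1)) (_ : Fin (n i)) => Fin m → 𝔸)).symm
  -- A push-forward need not be σ-finite; here it is, having a finite-valued density against a
  -- σ-finite measure.
  have hsf (i) : SigmaFinite ((volume : Measure (Matrix (Fin (n i)) (Fin m) 𝔸)).map (f i)) := by
    rw [hmap]
    infer_instance
  have h1 : (volume : Measure (Matrix (Σ i, Fin (n i)) (Fin m) 𝔸)).map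
      (fun X i => f i (rowBlock i X)) = Measure.pi fun i =>
        (volume : Measure (Matrix (Fin (n i)) (Fin m) 𝔸)).map (f i) := by
    rw [← Measure.pi_map_pi fun i => (hf i).aemeasurable]
    have hF : Measurable fun (x : (i : Fin (k + 1)) → Matrix (Fin (n i)) (Fin m) 𝔸) i =>
        f i (x i) := measurable_pi_lambda _ fun i => (hf i).comp (measurable_pi_apply i)
    refine Eq.trans ?_ (congrArg (Measure.map fun (x : (i : Fin (k + 1)) →
      Matrix (Fin (n i)) (Fin m) 𝔸) i => f i (x i)) hsplit.map_eq)
    exact (Measure.map_map hF hsplit.measurable).symm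
  have hset : {v : Fin (k + 1) → α | ∀ i, v i ∈ s} = Set.univ.pi fun _ => s := by
    ext v
    simp
  simp only [h1, hmap]
  rw [pi_withDensity_fin _ fun i => (hd i).ennreal_ofReal, hset, Measure.restrict_pi_pi]

/-- The common core of both parts: `f` is the statistic of a block, `d` its density under Lebesgue
measure, and `T` recovers tr XᴴX from the statistics, so that the kernel h becomes a function of
them. -/
theorem IsSpherical.map_rowBlock {Ω : Type*} [MeasurableSpace Ω] {P : Measure Ω} {h : ℝ → ℝ}
    (h_meas : Measurable h) {X : Ω → Matrix (Σ i, Fin (n i)) (Fin m) 𝔸} (hX : IsSpherical P h X)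
    {α : Type*} [MeasurableSpace α] (μ : Measure α) [SigmaFinite μ]
    {s : Set α} (hs : MeasurableSet s) (f : (i : Fin (k + 1)) → Matrix (Fin (n i)) (Fin m) 𝔸 → α)
    (hf : ∀ i, Measurable (f i)) {d : Fin (k + 1) → α → ℝ} (hd : ∀ i, Measurable (d i))
    (hd0 : ∀ i, ∀ v ∈ s, 0 ≤ d i v)
    (hmap : ∀ i, (volume : Measure (Matrix (Fin (n i)) (Fin m) 𝔸)).map (f i) =
      (μ.restrict s).withDensity fun v => ENNReal.ofReal (d i v))
    {T : (Fin (k + 1) → α) → ℝ} (hT : Measurable T)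
    (hfT : ∀ x : Matrix (Σ i, Fin (n i)) (Fin m) 𝔸,
      T (fun i => f i (rowBlock i x)) = reTrace (xᴴ * x)) :
    P.map (fun ω i => f i (rowBlock i (X ω))) =
      ((Measure.pi fun _ => μ).restrict {v | ∀ i, v i ∈ s}).withDensity
        fun v => ENNReal.ofReal ((∏ i, d i (v i)) * h (𝔸.dim * T v)) := by
  have hF : Measurable fun (x : Matrix (Σ i, Fin (n i)) (Fin m) 𝔸) i => f i (rowBlock i x) :=
    measurable_pi_lambda _ fun i => (hf i).comp
      (measurable_matrix_iff.2 fun a b => measurable_entry (⟨i, a⟩ : Σ i, Fin (n i)) b)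
  have hφ : Measurable fun v => ENNReal.ofReal (h (𝔸.dim * T v)) :=
    (h_meas.comp (hT.const_mul _)).ennreal_ofReal
  have hD : Measurable fun v : Fin (k + 1) → α => ∏ i, ENNReal.ofReal (d i (v i)) :=
    Finset.measurable_prod _ fun i _ => ((hd i).comp (measurable_pi_apply i)).ennreal_ofReal
  have hset : MeasurableSet {v : Fin (k + 1) → α | ∀ i, v i ∈ s} := by
    have : {v : Fin (k + 1) → α | ∀ i, v i ∈ s} = Set.univ.pi fun _ => s := by
      ext v
      simp
    rw [this]
    exact MeasurableSet.univ_pi fun _ => hs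
  have h1 : P.map (fun ω i => f i (rowBlock i (X ω))) =
      (P.map X).map fun x i => f i (rowBlock i x) :=
    (AEMeasurable.map_map_of_aemeasurable hF.aemeasurable hX.aemeasurable).symm
  have h2 : ((volume : Measure (Matrix (Σ i, Fin (n i)) (Fin m) 𝔸)).withDensity
      (fun x => ENNReal.ofReal (h (𝔸.dim * reTrace (xᴴ * x))))).map
        (fun x i => f i (rowBlock i x)) =
      ((volume : Measure (Matrix (Σ i, Fin (n i)) (Fin m) 𝔸)).map
        fun x i => f i (rowBlock i x)).withDensity
          fun v => ENNReal.ofReal (h (𝔸.dim * T v)) := by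
    refine Measure.ext_of_lintegral _ fun g hg => ?_
    have hφF : Measurable fun x : Matrix (Σ i, Fin (n i)) (Fin m) 𝔸 =>
        ENNReal.ofReal (h (𝔸.dim * reTrace (xᴴ * x))) :=
      (h_meas.comp ((measurable_reTrace.comp
        measurable_conjTranspose_mul_self).const_mul _)).ennreal_ofReal
    rw [lintegral_map hg hF]
    refine (lintegral_withDensity_eq_lintegral_mul _ hφF (hg.comp hF)).trans ?_
    rw [lintegral_withDensity_eq_lintegral_mul _ hφ hg, lintegral_map (hφ.mul hg) hF]
    simp [hfT]
  rw [h1, hX.map_eq, h2, map_rowBlock_volume μ f hf hd hmap, ← withDensity_mul _ hD hφ]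
  refine withDensity_congr_ae ?_
  filter_upwards [ae_restrict_mem hset] with v hv
  rw [Pi.mul_apply, ENNReal.ofReal_mul (Finset.prod_nonneg fun i _ => hd0 i _ (hv i)),
    ENNReal.ofReal_prod_of_nonneg fun i _ => hd0 i _ (hv i)]

theorem multiGamma_nonneg (h : 𝔸 = .octonion → m ≤ 2) (a : ℝ) : 0 ≤ multiGamma 𝔸 m a := by
  rw [multiGamma_eq_toReal h]
  exact ENNReal.toReal_nonneg

instance sigmaFinite_lebesgueHerm : SigmaFinite (lebesgueHerm 𝔸 m) := by
  -- A measurable left inverse of `hermOfCoords`; pushing forward along it gives back Lebesgue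
  -- measure, and σ-finiteness lifts from there.
  let φ : Matrix (Fin m) (Fin m) 𝔸 → (Fin m → ℝ) × ({p : Fin m × Fin m // p.1 < p.2} → 𝔸) :=
    fun S => (fun i => 𝔸.re (S i i), fun p => S p.1.1 p.1.2)
  have hφ : Measurable φ := by
    refine Measurable.prodMk ?_ ?_
    · exact measurable_pi_lambda _ fun i => 𝔸.measurable_re.comp (measurable_entry i i)
    · exact measurable_pi_lambda _ fun p => measurable_entry _ _
  have hinv : φ ∘ hermOfCoords 𝔸 m = id := by
    funext c
    refine Prod.ext (funext fun i => ?_) (funext fun p => ?_)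
    · simp [φ, hermOfCoords]
    · simp [φ, hermOfCoords, p.2]
  have hmap : (lebesgueHerm 𝔸 m).map φ = volume := by
    rw [lebesgueHerm, Measure.map_map hφ measurable_hermOfCoords, hinv, Measure.map_id]
  have : SigmaFinite ((lebesgueHerm 𝔸 m).map φ) := by
    rw [hmap]
    infer_instance
  exact this.of_map _ hφ.aemeasurable

end Blocks

/-! ### The two joint laws. -/

theorem mainTheorem2 {Ω : Type*} [MeasurableSpace Ω] (P : Measure Ω) [IsProbabilityMeasure P]
    (𝔸 : NormedDivAlg) (k m : ℕ) (hm : 1 ≤ m) (n : Fin (k + 1) → ℕ) (hn : ∀ i, m ≤ n i)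
    (h : ℝ → ℝ) (h_meas : Measurable h) (h_nonneg : ∀ t, 0 ≤ t → 0 ≤ h t)
    (X : Ω → Matrix (Σ i, Fin (n i)) (Fin m) 𝔸) (hX : IsSpherical P h X) :
    -- the joint law of the traces
    P.map (fun ω i => reTrace ((rowBlock i (X ω))ᴴ * rowBlock i (X ω))) =
      ((volume : Measure (Fin (k + 1) → ℝ)).restrict {v | ∀ i, 0 < v i}).withDensity
        (fun v => ENNReal.ofReal
          (Real.pi ^ (((∑ i, n i : ℕ) : ℝ) * m * 𝔸.dim / 2) *
            (∏ i, v i ^ ((n i : ℝ) * m * 𝔸.dim / 2 - 1) /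
              multiGamma 𝔸 1 ((n i : ℝ) * m * 𝔸.dim / 2)) *
            h (𝔸.dim * ∑ i, v i))) ∧
    -- the joint law of the matrices
    ((𝔸 = NormedDivAlg.octonion → m ≤ 2) →
      P.map (fun ω i => (rowBlock i (X ω))ᴴ * rowBlock i (X ω)) =
        ((Measure.pi fun _ : Fin (k + 1) => lebesgueHerm 𝔸 m).restrict
          {V | ∀ i, IsPosDef (V i)}).withDensity
          (fun V => ENNReal.ofReal
            (Real.pi ^ ((𝔸.dim : ℝ) * ((∑ i, n i : ℕ) : ℝ) * m / 2) *
              (∏ i, hermDet (V i) ^ ((𝔸.dim : ℝ) * ((n i : ℝ) - m + 1) / 2 - 1) /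
                multiGamma 𝔸 m ((𝔸.dim : ℝ) * n i / 2)) *
              h (𝔸.dim * reTrace (∑ i, V i))))) := by
  have hn0 (i) : 0 < n i := hm.trans (hn i)
  constructor
  · have key := hX.map_rowBlock h_meas (volume : Measure ℝ) measurableSet_Ioi
      (fun i Y => reTrace (Yᴴ * Y))
      (fun i => measurable_reTrace.comp measurable_conjTranspose_mul_self)
      (d := fun i v => Real.pi ^ ((n i : ℝ) * m * 𝔸.dim / 2) *
          (v ^ ((n i : ℝ) * m * 𝔸.dim / 2 - 1) / multiGamma 𝔸 1 ((n i : ℝ) * m * 𝔸.dim / 2)))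
      (fun i => by fun_prop)
      (fun i v hv => mul_nonneg (Real.rpow_nonneg Real.pi_pos.le _)
        (div_nonneg (Real.rpow_nonneg (le_of_lt hv) _) (multiGamma_nonneg (fun _ => one_le_two) _)))
      (fun i => map_reTrace_conjTranspose_mul_self hm (hn0 i))
      (T := fun v => ∑ i, v i) (by fun_prop) sum_reTrace_rowBlock
    refine key.trans ?_
    -- The powers of π of the separate blocks multiply to the single one in the statement, since n
    -- is the sum of the nᵢ.
    have hc : Real.pi ^ (((∑ i, n i : ℕ) : ℝ) * m * 𝔸.dim / 2) =
        ∏ i, Real.pi ^ ((n i : ℝ) * m * 𝔸.dim / 2) := by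
      rw [← Real.rpow_sum_of_pos Real.pi_pos, Nat.cast_sum]
      simp only [Finset.sum_mul, Finset.sum_div]
    simp only [hc, Finset.prod_mul_distrib]
    rfl
  · intro h𝔸
    have hT : Measurable fun V : Fin (k + 1) → Matrix (Fin m) (Fin m) 𝔸 => reTrace (∑ i, V i) := by
      simp only [reTrace_sum]
      exact Finset.measurable_sum _ fun i _ => measurable_reTrace.comp (measurable_pi_apply i)
    have key := hX.map_rowBlock h_meas (lebesgueHerm 𝔸 m) (measurableSet_isPosDef h𝔸)
      (fun i Y => Yᴴ * Y) (fun i => measurable_conjTranspose_mul_self)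
      (d := fun i V => Real.pi ^ ((𝔸.dim : ℝ) * n i * m / 2) *
          (hermDet V ^ ((𝔸.dim : ℝ) * ((n i : ℝ) - m + 1) / 2 - 1) /
            multiGamma 𝔸 m ((𝔸.dim : ℝ) * n i / 2)))
      (fun i => ((measurable_hermDet.pow_const _).div_const _).const_mul _)
      (fun i V hV => mul_nonneg (Real.rpow_nonneg Real.pi_pos.le _)
        (div_nonneg (Real.rpow_nonneg (IsPosDef.hermDet_pos h𝔸 hV).le _)
          (multiGamma_nonneg h𝔸 _)))
      (fun i => map_conjTranspose_mul_self h𝔸 (hn i))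
      (T := fun V => reTrace (∑ i, V i)) hT
      (fun x => by rw [reTrace_sum, sum_reTrace_rowBlock])
    refine key.trans ?_
    have hc : Real.pi ^ ((𝔸.dim : ℝ) * ((∑ i, n i : ℕ) : ℝ) * m / 2) =
        ∏ i, Real.pi ^ ((𝔸.dim : ℝ) * n i * m / 2) := by
      rw [← Real.rpow_sum_of_pos Real.pi_pos, Nat.cast_sum]
      simp only [Finset.mul_sum, Finset.sum_mul, Finset.sum_div]
    simp only [hc, Finset.prod_mul_distrib]
    rfl
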